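/- **Setting.** Let $q(x_1,\dots,x_k)=S_1(\bar x_1),\dots,S_\ell(\bar x_\ell)$ be a full conjunctive query without self-joins: every variable occurs in some atom, and all variables are in the head. Let $a_j$ be the arity of $S_j$ and $\mathrm{vars}(S_j)$ the set of variables of its atom. Assume that the hypergraph of $q$ (nodes: variables, hyperedges: the sets $\mathrm{vars}(S_j)$) is connected, and that every atom contains at least two distinct variables. Let $\chi(q)=k+\ell-\sum_j a_j-1$. A fractional vertex cover is a vector $v\in\mathbb R_{\ge0}^k$ with $\sum_{x_i\in \mathrm{vars}(S_j)}v_i\ge1$ for all $j$, and $\tau^*(q)$ is the infimum of $\sum_i v_i$ over all fractional vertex covers. A matching database over $[n]$ consists of relations $S_j\subseteq[n]^{a_j}$ with exactly $n$ tuples, each of whose columns contains every value of $[n]$ exactly once; $N=\sum_j(a_j-1)\log_2(n!)$ is its size in bits. In a one-round algorithm with $p$ workers, each relation $S_j$ is stored on its own input server, which sends to each worker an arbitrary bit string that depends on $S_j$ and on public random bits; then each worker reports a set of tuples that depends on the strings it received and on the random bits. Workers report only tuples that are certain to be answers: on every matching database and for every value of the random bits, all reported tuples are in $q(I)$. In the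 model $\mathrm{MPC}(\varepsilon)$ with load constant $c$, the algorithm fails on $I$ if some worker receives more than $cN/p^{1-\varepsilon}$ bits, or if the set of all reported tuples is not $q(I)$. **Theorem 1.** (Lower bound.) For all $0\le\varepsilon<1-1/\tau^*(q)$ and $c>0$ there are $\delta>0$ and $p_0$, depending only on $q,\varepsilon,c$, such that for all $p\ge p_0$ and $n\ge2$, every randomized one-round algorithm with $p$ workers fails, in $\mathrm{MPC}(\varepsilon)$ with load constant $c$, with probability at least $\delta\,n^{\chi(q)}$ on some matching database over $[n]$. Hence computing $q$ in one round requires space exponent $\varepsilon\ge1-1/\tau^*(q)$, even on matching databases. (Upper bound.) This is optimal on matching databases. The infimum $\tau^*(q)$ is attained. For every fractional vertex cover $v$, with $\tau=\sum_iv_i$ and $\varepsilon=1-1/\tau$, there are constants $c,C,\delta>0$ such that, for all $p\ge1$ and $n\ge2$ with $n\ge C\,p^{1-\varepsilon}\ln p$, the HyperCube algorithm with shares $p_i=\lfloor p^{v_i/\tau}\rfloor$ reports only correct answers on matching databases over $[n]$, and on each of them it fails, in $\mathrm{MPC}(\varepsilon)$ with load constant $c$, with probability at most $\exp(-\delta n/p^{1-\varepsilon})$.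 Here the HyperCube algorithm places $\prod_ip_i\le p$ of the workers at the points of $[p_1]\times\dots\times[p_k]$ and draws independent uniformly random hash functions $h_i:[n]\to[p_i]$. It sends each tuple $(\alpha_{i_1},\dots,\alpha_{i_a})$ of $S_j$, where $S_j(x_{i_1},\dots,x_{i_a})$ is the atom of $S_j$, to all workers $y$ with $y_{i_m}=h_{i_m}(\alpha_{i_m})$ for all $m$ (tuples that give two values to one repeated variable are dropped), encoded in $\lceil\log_2n\rceil$ bits per value. Each worker reports all the answers that can be derived from the tuples it received. In particular, $\varepsilon=1-1/\tau^*(q)$ suffices on matching databases. -/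

import Mathlib

open Finset MeasureTheory

noncomputable section

/-- A full conjunctive query without self-joins,
`q(x_0, …, x_{numVars-1}) = S_0(x̄_0), …, S_{numAtoms-1}(x̄_{numAtoms-1})`.
The relation symbols are the atoms themselves, so no symbol is used twice; the head consists of
all the variables, and every variable occurs in the body.  A variable may be repeated inside an
atom. -/
structure ConjunctiveQuery where
  numVars : ℕ
  numAtoms : ℕ
  arity : Fin numAtoms → ℕ
  arity_pos : ∀ j, 0 < arity j
  /-- `atom j m` is the variable at position `m` of the atom `S_j`. -/
  atom : (j : Fin numAtoms) → Fin (arity j) → Fin numVars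
  occurs : ∀ i, ∃ j m, atom j m = i

/-- A tuple of length `a` over the domain `[n]`, represented by `Fin n`. -/
abbrev Tup (a n : ℕ) : Type := Fin a → Fin n

/-- `R` is an `a`-dimensional matching on `[n]`: it has `n` tuples, and each column contains
every value of the domain exactly once. -/
def IsMatchingRelation {a n : ℕ} (R : Finset (Tup a n)) : Prop :=
  R.card = n ∧ ∀ m : Fin a, Set.BijOn (fun t : Tup a n => t m) (R : Set (Tup a n)) Set.univ

namespace ConjunctiveQuery

/-- The set of variables of the atom `S_j`: a hyperedge of the hypergraph of the query. -/
def vars (q : ConjunctiveQuery) (j : Fin q.numAtoms) : Finset (Fin q.numVars) :=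
  Finset.univ.image (q.atom j)

/-- Two distinct variables are adjacent when they lie in a common hyperedge. -/
def primalGraph (q : ConjunctiveQuery) : SimpleGraph (Fin q.numVars) where
  Adj x y := x ≠ y ∧ ∃ j, x ∈ q.vars j ∧ y ∈ q.vars j
  symm := ⟨fun _ _ h => ⟨h.1.symm, h.2.imp fun _ hj => ⟨hj.2, hj.1⟩⟩⟩
  loopless := ⟨fun _ h => h.1 rfl⟩

/-- The hypergraph of the query is connected (and nonempty). -/
def IsConnected (q : ConjunctiveQuery) : Prop := q.primalGraph.Connected

/-- The characteristic `χ(q) = k + ℓ - ∑ⱼ aⱼ - c`, with `c` the number of connected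
components. -/
def characteristic (q : ConjunctiveQuery) : ℤ :=
  (q.numVars : ℤ) + q.numAtoms - ∑ j, (q.arity j : ℤ) - Nat.card q.primalGraph.ConnectedComponent

/-- Feasible solutions of the vertex covering linear program. -/
def IsFractionalVertexCover (q : ConjunctiveQuery) (v : Fin q.numVars → ℝ) : Prop :=
  (∀ i, 0 ≤ v i) ∧ ∀ j, 1 ≤ ∑ i ∈ q.vars j, v i

/-- The fractional covering number `τ*(q)`: the optimal value of the vertex covering linear
program. -/
def fractionalCoveringNumber (q : ConjunctiveQuery) : ℝ :=
  sInf {t : ℝ | ∃ v, q.IsFractionalVertexCover v ∧ t = ∑ i, v i}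

/-- A database instance over the domain `[n]`. -/
abbrev Database (q : ConjunctiveQuery) (n : ℕ) : Type :=
  (j : Fin q.numAtoms) → Finset (Tup (q.arity j) n)

/-- A matching database: every relation is a matching. -/
def IsMatchingDatabase (q : ConjunctiveQuery) {n : ℕ} (I : q.Database n) : Prop :=
  ∀ j, IsMatchingRelation (I j)

/-- The answer `q(I)` of the query on the database `I`. -/
def answers (q : ConjunctiveQuery) {n : ℕ} (I : q.Database n) : Set (Tup q.numVars n) :=
  {α | ∀ j, (fun m => α (q.atom j m)) ∈ I j}

/-- The size `N = ∑ⱼ (aⱼ - 1) log₂(n!)` in bits of a matching database: there are `(n!)^(a-1)`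
matchings of arity `a` on `[n]`. -/
def inputBits (q : ConjunctiveQuery) (n : ℕ) : ℝ :=
  ∑ j, ((q.arity j : ℝ) - 1) * Real.logb 2 (n.factorial : ℝ)

/-- The number `c · N / p^(1-ε)` of bits that a worker may receive in the model `MPC(ε)`, where
`c` is the constant hidden in the notation `O(N / p^(1-ε))`. -/
def loadLimit (q : ConjunctiveQuery) (n p : ℕ) (ε c : ℝ) : ℝ :=
  c * q.inputBits n / (p : ℝ) ^ (1 - ε)

end ConjunctiveQuery

/-- A deterministic one-round algorithm with `p` workers, for databases over `[n]`.  Each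
relation is stored on its own input server, which sends an arbitrary bit string, computed from
that relation alone, to each worker; then each worker reports a set of tuples that depends only on
the bit strings it has received.  A randomized algorithm with public random bits is a family of
such algorithms, indexed by a probability space. -/
structure OneRoundAlgorithm (q : ConjunctiveQuery) (n p : ℕ) where
  message : (j : Fin q.numAtoms) → Fin p → Finset (Tup (q.arity j) n) → List Bool
  report : Fin p → (Fin q.numAtoms → List Bool) → Set (Tup q.numVars n)

namespace OneRoundAlgorithm

variable {q : ConjunctiveQuery} {n p : ℕ}

/-- The number of bits that the worker `u` receives on the input `I`. -/
def bitsReceived (A : OneRoundAlgorithm q n p) (I : q.Database n) (u : Fin p) : ℕ :=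
  ∑ j, (A.message j u (I j)).length

/-- The set of all tuples reported by the workers on the input `I`. -/
def output (A : OneRoundAlgorithm q n p) (I : q.Database n) : Set (Tup q.numVars n) :=
  ⋃ u, A.report u (fun j => A.message j u (I j))

/-- The workers report only correct answers, whenever the input is a matching database.
Equivalently, a worker reports a tuple only if it knows from its messages that the tuple is an
answer: the tuple is an answer on all the matching databases that lead to the same messages. -/
def IsSound (A : OneRoundAlgorithm q n p) : Prop :=
  ∀ I : q.Database n, q.IsMatchingDatabase I → A.output I ⊆ q.answers I

/-- The algorithm fails on `I` under the load limit `L`: some worker receives more than `L` bits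
(the computation is aborted), or the answer is not computed. -/
def Fails (A : OneRoundAlgorithm q n p) (L : ℝ) (I : q.Database n) : Prop :=
  (∃ u, L < (A.bitsReceived I u : ℝ)) ∨ A.output I ≠ q.answers I

end OneRoundAlgorithm

/-- The binary representation of an element of `[n]` by `⌈log₂ n⌉` bits. -/
def encodeValue {n : ℕ} (x : Fin n) : List Bool :=
  List.ofFn fun b : Fin (Nat.clog 2 n) => (x : ℕ).testBit b

/-- The representation of a tuple by `a ⌈log₂ n⌉` bits. -/
def encodeTuple {a n : ℕ} (t : Tup a n) : List Bool :=
  (List.ofFn t).flatMap encodeValue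

/-- The concatenation of the representations of the tuples of a list. -/
def encodeTuples {a n : ℕ} (T : List (Tup a n)) : List Bool :=
  T.flatMap encodeTuple

/-- The tuples that are listed in the message `msg`. -/
def decodeTuples (a n : ℕ) (msg : List Bool) : Set (Tup a n) :=
  {t | ∃ T : List (Tup a n), encodeTuples T = msg ∧ t ∈ T}

namespace ConjunctiveQuery

/-- The shares `pᵢ = p^(eᵢ)`, rounded down to integers, for the share exponents
`eᵢ = vᵢ / ∑ᵢ' vᵢ'`. -/
def shares (q : ConjunctiveQuery) (v : Fin q.numVars → ℝ) (p : ℕ) (i : Fin q.numVars) : ℕ :=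
  ⌊(p : ℝ) ^ (v i / ∑ i', v i')⌋₊

/-- The families of hash functions `hᵢ : [n] → [pᵢ]`, one for each variable.  The uniform
distribution on this finite type makes them uniform and independent. -/
abbrev Hashes (q : ConjunctiveQuery) (s : Fin q.numVars → ℕ) (n : ℕ) : Type :=
  (i : Fin q.numVars) → Fin n → Fin (s i)

/-- The worker `u` is located at the point `y` of the hypercube `∏ᵢ [sᵢ]`, under the mixed radix
numbering of the points.  Workers numbered `∏ᵢ sᵢ` or more have no location and stay idle. -/
def LocatedAt (q : ConjunctiveQuery) (s : Fin q.numVars → ℕ) {p : ℕ} (u : Fin p)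
    (y : (i : Fin q.numVars) → Fin (s i)) : Prop :=
  ((finPiFinEquiv y : Fin (∏ i, s i)) : ℕ) = u

/-- The HyperCube algorithm sends the tuple `t` of `S_j` to the worker `u` if `t` is an instance
`(α_{i₁}, …, α_{i_a})` of the atom `S_j(x_{i₁}, …, x_{i_a})` and the location of `u` agrees with
the hash value of `t` in each of the dimensions `i₁, …, i_a`. -/
def HyperCubeSends (q : ConjunctiveQuery) (s : Fin q.numVars → ℕ) {n p : ℕ} (h : q.Hashes s n)
    (j : Fin q.numAtoms) (u : Fin p) (t : Tup (q.arity j) n) : Prop :=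
  (∀ m m', q.atom j m = q.atom j m' → t m = t m') ∧
    ∃ y, q.LocatedAt s u y ∧ ∀ m, h (q.atom j m) (t m) = y (q.atom j m)

open Classical in
/-- The HyperCube algorithm with shares `s` and hash functions `h`: the tuples are routed as
above, and each worker reports all the answers that can be derived from the tuples it receives. -/
def hyperCube (q : ConjunctiveQuery) (s : Fin q.numVars → ℕ) (n p : ℕ) (h : q.Hashes s n) :
    OneRoundAlgorithm q n p where
  message j u R := encodeTuples (R.filter (q.HyperCubeSends s h j u)).toList
  report _ msg := {α | ∀ j, (fun m => α (q.atom j m)) ∈ decodeTuples (q.arity j) n (msg j)}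

end ConjunctiveQuery

end

/-! Lower bound. Draw each matching from independent uniform permutations, one per variable, and
average over these inputs. A worker of a sound algorithm that reports `α` must be able to infer,
from the message about `S_j` alone, that `S_j` contains the restriction of `α` (`IsSound.knows`),
because the input servers work independently. Fixing `K` tuples of a matching costs about a fraction
`K / n` of its `log₂ n!` bits, so `L` bits reveal on average at most a fraction `β = (L + 2) / log₂
n!` of `S_j` (`sum_card_knows_le`). Finner's inequality with an optimal fractional edge packing,
whose value is `τ*` by duality, combines the atoms: one worker finds at most a fraction `β ^ τ*` of
the expected answers (`sum_prod_le_of_packing`).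

For `ε < 1 - 1/τ*` and large `p`, all the workers together find at most half of the expected answers
without failing, so the failing inputs carry the other half. Connectivity allows at most `n` answers
per input, and there are at least `n ^ (χ + 1)` on average, so at least a fraction `n ^ χ / 2` of
the inputs fail. Averaging over the random bits then selects one bad input.

Upper bound. Every answer is assembled at the worker whose point is its vector of hash values. A
tuple of `S_j` reaches a given point with probability at most `2 ^ k * p ^ (-1/τ)`, because the
cover gives the atom total weight at least 1. The columns of a matching are injective, so different
tuples are hashed independently; a Chernoff bound and a union bound over workers and atoms control
the load. -/

namespace ConjunctiveQuery

/-! ### Fractional vertex covers and linear programming duality -/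

variable {q : ConjunctiveQuery}

theorem mem_vars (q : ConjunctiveQuery) (j : Fin q.numAtoms) (m : Fin (q.arity j)) :
    q.atom j m ∈ q.vars j :=
  mem_image_of_mem _ (mem_univ m)

theorem vars_nonempty (q : ConjunctiveQuery) (j : Fin q.numAtoms) : (q.vars j).Nonempty :=
  ⟨_, q.mem_vars j ⟨0, q.arity_pos j⟩⟩

theorem card_vars_le_arity (q : ConjunctiveQuery) (j : Fin q.numAtoms) :
    (q.vars j).card ≤ q.arity j := by
  simpa [vars] using card_image_le (s := univ) (f := q.atom j)

/-- Truncation at 1 keeps each constraint: either one truncated weight already equals 1, or nothing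
in the atom changes. It confines the minimization to a compact cube. -/
theorem IsFractionalVertexCover.inf_one {v : Fin q.numVars → ℝ}
    (hv : q.IsFractionalVertexCover v) : q.IsFractionalVertexCover fun i => min (v i) 1 := by
  refine ⟨fun i => le_min (hv.1 i) zero_le_one, fun j => ?_⟩
  by_cases h : ∃ i ∈ q.vars j, 1 ≤ v i
  · obtain ⟨i, hi, h1⟩ := h
    calc (1 : ℝ) = min (v i) 1 := (min_eq_right h1).symm
      _ ≤ _ := single_le_sum (f := fun i => min (v i) 1)
        (fun i _ => le_min (hv.1 i) zero_le_one) hi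
  · push Not at h
    rw [sum_congr rfl fun i hi => min_eq_left (h i hi).le]
    exact hv.2 j

theorem isFractionalVertexCover_one (q : ConjunctiveQuery) :
    q.IsFractionalVertexCover fun _ => 1 :=
  ⟨fun _ => zero_le_one, fun j => by
    simpa using (q.vars_nonempty j).card_pos⟩

theorem isClosed_setOf_isFractionalVertexCover (q : ConjunctiveQuery) :
    IsClosed {v | q.IsFractionalVertexCover v} := by
  simp only [IsFractionalVertexCover, Set.ofPred_and, Set.ofPred_forall]
  exact (isClosed_iInter fun i => isClosed_le continuous_const (continuous_apply i)).inter
    (isClosed_iInter fun j => isClosed_le continuous_const (by fun_prop))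

theorem fractionalCoveringNumber_le {v : Fin q.numVars → ℝ} (hv : q.IsFractionalVertexCover v) :
    q.fractionalCoveringNumber ≤ ∑ i, v i :=
  csInf_le ⟨0, by rintro _ ⟨w, hw, rfl⟩; exact sum_nonneg fun i _ => hw.1 i⟩ ⟨v, hv, rfl⟩

theorem exists_cover_eq_fractionalCoveringNumber (q : ConjunctiveQuery) :
    ∃ v, q.IsFractionalVertexCover v ∧ ∑ i, v i = q.fractionalCoveringNumber := by
  have hK : IsCompact (Set.Icc (0 : Fin q.numVars → ℝ) 1 ∩ {v | q.IsFractionalVertexCover v}) :=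
    isCompact_Icc.inter_right q.isClosed_setOf_isFractionalVertexCover
  obtain ⟨v, hv, hmin⟩ := hK.exists_isMinOn
    ⟨fun _ => 1, ⟨fun _ => zero_le_one, fun _ => le_rfl⟩, q.isFractionalVertexCover_one⟩
    (f := fun v => ∑ i, v i) (by fun_prop)
  refine ⟨v, hv.2, le_antisymm (le_csInf ⟨_, v, hv.2, rfl⟩ ?_) (fractionalCoveringNumber_le hv.2)⟩
  rintro _ ⟨w, hw, rfl⟩
  refine (hmin ⟨⟨fun i => hw.inf_one.1 i, fun i => min_le_right _ _⟩, hw.inf_one⟩).trans ?_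
  exact sum_le_sum fun i _ => min_le_left _ _

theorem IsFractionalVertexCover.one_le_sum {v : Fin q.numVars → ℝ}
    (hv : q.IsFractionalVertexCover v) (j : Fin q.numAtoms) : 1 ≤ ∑ i, v i :=
  (hv.2 j).trans (sum_le_sum_of_subset_of_nonneg (subset_univ _) fun i _ _ => hv.1 i)

theorem one_le_fractionalCoveringNumber (j : Fin q.numAtoms) :
    1 ≤ q.fractionalCoveringNumber := by
  obtain ⟨v, hv, h⟩ := q.exists_cover_eq_fractionalCoveringNumber
  exact h ▸ hv.one_le_sum j

/-- Linear programming duality: the optimal fractional edge packing has the value of the optimal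
fractional vertex cover. -/
theorem exists_packing_eq_fractionalCoveringNumber (j₀ : Fin q.numAtoms) :
    ∃ u : Fin q.numAtoms → ℝ, (∀ j, 0 ≤ u j) ∧ (∀ i, ∑ j with i ∈ q.vars j, u j ≤ 1) ∧
      ∑ j, u j = q.fractionalCoveringNumber := by
  set τ := q.fractionalCoveringNumber with hτ
  have hτ1 : 1 ≤ τ := one_le_fractionalCoveringNumber j₀
  have hτ0 : 0 < τ := by linarith
  -- Packings of value `τ`, divided by `τ`, are the points of the simplex whose vertex loads are at
  -- most `1 / τ`. If there are none, the compact convex set of load vectors is separated from the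
  -- orthant below `1 / τ`, and the separating functional yields a cover of value less than `τ`.
  by_cases hex : ∃ u ∈ stdSimplex ℝ (Fin q.numAtoms), ∀ i, ∑ j with i ∈ q.vars j, u j ≤ 1 / τ
  · obtain ⟨u, hu, h⟩ := hex
    refine ⟨fun j => τ * u j, fun j => mul_nonneg hτ0.le (hu.1 j), fun i => ?_, ?_⟩
    · rw [← mul_sum]
      calc τ * _ ≤ τ * (1 / τ) := by gcongr; exact h i
        _ = 1 := by field_simp
    · rw [← mul_sum, hu.2, mul_one]
  exfalso
  push Not at hex
  let T : (Fin q.numAtoms → ℝ) →ₗ[ℝ] (Fin q.numVars → ℝ) :=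
    { toFun := fun u i => ∑ j with i ∈ q.vars j, u j
      map_add' := fun u w => by ext i; simp [sum_add_distrib]
      map_smul' := fun r u => by ext i; simp [mul_sum] }
  have hTc : Continuous T := T.continuous_of_finiteDimensional
  obtain ⟨f, a, b, ha, hab, hb⟩ := geometric_hahn_banach_closed_compact
    (s := Set.Iic fun _ : Fin q.numVars => 1 / τ) (t := T '' stdSimplex ℝ (Fin q.numAtoms))
    (convex_Iic _) isClosed_Iic ((convex_stdSimplex ℝ _).linear_image T)
    ((isCompact_stdSimplex ℝ _).image hTc) (by
      rw [Set.disjoint_left]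
      rintro _ hx ⟨u, hu, rfl⟩
      obtain ⟨i, hi⟩ := hex u hu
      exact absurd (hx i) (not_le.2 hi))
  set c : Fin q.numVars → ℝ := fun i => f (Pi.single i 1) with hc
  have hf : ∀ x, f x = ∑ i, x i * c i := fun x => by
    conv_lhs => rw [← univ_sum_single x]
    rw [map_sum]
    refine sum_congr rfl fun i _ => ?_
    rw [hc, ← smul_eq_mul, ← map_smul, ← Pi.single_smul, smul_eq_mul, mul_one]
  -- The functional is bounded above on an orthant that is unbounded below in each coordinate, so no
  -- coefficient can be negative.
  have hc0 : ∀ i, 0 ≤ c i := fun i => by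
    by_contra hlt
    push Not at hlt
    have key : ∀ t : ℝ, 0 ≤ t → ∑ i, 1 / τ * c i - t * c i < a := fun t ht => by
      have := ha ((fun _ => 1 / τ) - t • Pi.single i 1) (by
        intro i'
        by_cases h : i' = i
        · subst h; simp [ht]
        · simp [h])
      rwa [map_sub, map_smul, hf, smul_eq_mul] at this
    have h2 := key ((|a - ∑ i, 1 / τ * c i| + 1) / (-c i)) (div_nonneg (by positivity) (by linarith))
    have : (|a - ∑ i, 1 / τ * c i| + 1) / (-c i) * c i = -(|a - ∑ i, 1 / τ * c i| + 1) := by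
      have := hlt.ne
      field_simp
    rw [this] at h2
    linarith [le_abs_self (a - ∑ i, 1 / τ * c i)]
  have h1 : 1 / τ * ∑ i, c i < a := by
    have := ha (fun _ => 1 / τ) (Set.mem_Iic.2 le_rfl)
    rwa [hf, ← mul_sum] at this
  have h2 : ∀ j, b < ∑ i ∈ q.vars j, c i := fun j => by
    have := hb _ ⟨_, single_mem_stdSimplex ℝ j, rfl⟩
    rw [hf] at this
    refine this.trans_eq ?_
    have hT : ∀ i, T (Pi.single j 1) i = if i ∈ q.vars j then 1 else 0 := fun i => by
      change ∑ j' with i ∈ q.vars j', (Pi.single j 1 : Fin q.numAtoms → ℝ) j' = _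
      simp [Pi.single_apply, sum_ite_eq']
    simp [hT]
  set C := ∑ i, c i with hC
  have hC0 : 0 ≤ C := sum_nonneg fun i _ => hc0 i
  have hb0 : 0 < b := lt_of_le_of_lt (by positivity) (h1.trans hab)
  have hcov : q.IsFractionalVertexCover fun i => c i / b :=
    ⟨fun i => div_nonneg (hc0 i) hb0.le, fun j => by
      rw [← sum_div, le_div_iff₀ hb0, one_mul]; exact (h2 j).le⟩
  have := fractionalCoveringNumber_le hcov
  rw [← sum_div, ← hτ, le_div_iff₀ hb0, ← hC] at this
  have h3 : C < b * τ := by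
    have := h1.trans hab
    rwa [one_div, inv_mul_eq_div, div_lt_iff₀ hτ0] at this
  linarith

end ConjunctiveQuery

/-! ### Finner's inequality -/

open scoped ENNReal in
/-- Finner's inequality on a product of probability spaces, for some of the variables. -/
theorem lmarginal_prod_rpow_le {ι κ X : Type*} [DecidableEq ι] [Fintype κ]
    [MeasurableSpace X] (μ : Measure X) [IsProbabilityMeasure μ] (V : κ → Finset ι)
    (f : κ → (ι → X) → ℝ≥0∞) (hf : ∀ j, Measurable (f j))
    (hV : ∀ j, ∀ i ∉ V j, ∀ x y, f j (Function.update x i y) = f j x)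
    (u : κ → ℝ) (hu : ∀ j, 0 ≤ u j) (hpack : ∀ i, ∑ j with i ∈ V j, u j ≤ 1) (s : Finset ι)
    (x : ι → X) :
    lmarginal (fun _ => μ) s (fun x => ∏ j, f j x ^ u j) x ≤
      ∏ j, lmarginal (fun _ => μ) s (f j) x ^ u j := by
  induction s using Finset.induction_on generalizing x with
  | empty => simp
  | insert i s hi ih =>
    have hmeas : Measurable fun x => ∏ j, f j x ^ u j := by fun_prop
    have hm : ∀ j, Measurable (lmarginal (fun _ => μ) s (f j)) := fun j => (hf j).lmarginal _
    rw [lmarginal_insert _ hmeas hi]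
    refine (lintegral_mono fun y => ih _).trans ?_
    -- Factors that do not involve coordinate `i` come out of the integral over it.
    have hconst : ∀ j, i ∉ V j → ∀ y,
        lmarginal (fun _ => μ) s (f j) (Function.update x i y) =
          lmarginal (fun _ => μ) (insert i s) (f j) x := by
      intro j hj y
      have h1 : ∀ y, lmarginal (fun _ => μ) s (f j) (Function.update x i y) =
          lmarginal (fun _ => μ) s (f j) x := fun y => by
        rw [lmarginal_update_of_notMem (hf j) hi]
        congr 1
        ext z
        exact hV j i hj z y
      rw [lmarginal_insert _ (hf j) hi]
      simp [h1]
    have hsplit : ∀ F : κ → ℝ≥0∞, ∏ j, F j =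
        (∏ j with i ∉ V j, F j) * ∏ j with i ∈ V j, F j := fun F => by
      rw [mul_comm, prod_filter_mul_prod_filter_not]
    simp only [hsplit]
    have hc : ∀ y, ∏ j with i ∉ V j,
        lmarginal (fun _ => μ) s (f j) (Function.update x i y) ^ u j =
        ∏ j with i ∉ V j, lmarginal (fun _ => μ) (insert i s) (f j) x ^ u j := fun y =>
      prod_congr rfl fun j hj => by rw [hconst j (mem_filter.1 hj).2]
    simp only [hc]
    have hmu : ∀ j, Measurable fun y => lmarginal (fun _ => μ) s (f j) (Function.update x i y) :=
      fun j => (hm j).comp (measurable_update x)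
    rw [lintegral_const_mul _ (by fun_prop)]
    gcongr
    -- Hölder in coordinate `i`. The exponents of the factors involving `i` sum to at most 1; the
    -- constant function 1 takes up the slack, which costs nothing on a probability space.
    have := ENNReal.lintegral_mul_prod_norm_pow_le (μ := μ) ({j | i ∈ V j} : Finset κ)
      (g := fun _ => 1)
      (f := fun j y => lmarginal (fun _ => μ) s (f j) (Function.update x i y))
      aemeasurable_const (fun j _ => (hmu j).aemeasurable) (1 - ∑ j with i ∈ V j, u j)
      (p := u) (by ring) (by linarith [hpack i]) (fun j _ => hu j)
    simp only [ENNReal.one_rpow, one_mul, lintegral_const, measure_univ, mul_one] at this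
    refine this.trans (le_of_eq (prod_congr rfl fun j _ => ?_))
    rw [lmarginal_insert _ (hf j) hi]

/-- Finner's inequality for sums over a finite cube. -/
theorem sum_prod_rpow_div_le {ι κ X : Type*} [Fintype ι] [DecidableEq ι] [Fintype κ]
    [Fintype X] [Nonempty X] (V : κ → Finset ι) (f : κ → (ι → X) → ℝ)
    (hf : ∀ j x, 0 ≤ f j x)
    (hV : ∀ j, ∀ i ∉ V j, ∀ x y, f j (Function.update x i y) = f j x)
    (u : κ → ℝ) (hu : ∀ j, 0 ≤ u j) (hpack : ∀ i, ∑ j with i ∈ V j, u j ≤ 1) :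
    (∑ x, ∏ j, f j x ^ u j) / (Fintype.card X : ℝ) ^ Fintype.card ι ≤
      ∏ j, ((∑ x, f j x) / (Fintype.card X : ℝ) ^ Fintype.card ι) ^ u j := by
  let _ : MeasurableSpace X := ⊤
  set μ : Measure X := ProbabilityTheory.uniformOn Set.univ with hμ
  have hμ1 : ∀ y, μ {y} = (Fintype.card X : ENNReal)⁻¹ := fun y => by
    rw [hμ, ProbabilityTheory.uniformOn_univ]
    simp
  have hint : ∀ g : (ι → X) → ℝ, (∀ x, 0 ≤ g x) → ∀ x₀,
      lmarginal (fun _ => μ) univ (fun x => ENNReal.ofReal (g x)) x₀ =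
        ENNReal.ofReal ((∑ x, g x) / (Fintype.card X : ℝ) ^ Fintype.card ι) := fun g hg x₀ => by
    rw [lmarginal_univ, lintegral_fintype, sum_div, ENNReal.ofReal_sum_of_nonneg]
    · refine sum_congr rfl fun x _ => ?_
      rw [Measure.pi_singleton]
      simp only [hμ1, prod_const, card_univ]
      rw [div_eq_mul_inv, ENNReal.ofReal_mul (hg x), ENNReal.ofReal_inv_of_pos (by positivity),
        ENNReal.ofReal_pow (by positivity), ENNReal.ofReal_natCast, ENNReal.inv_pow]
    · intro x _
      have := hg x
      positivity
  obtain ⟨x₀⟩ : Nonempty (ι → X) := inferInstance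
  have := lmarginal_prod_rpow_le μ V (fun j x => ENNReal.ofReal (f j x))
    (fun j => measurable_of_finite _) (fun j i hi x y => by rw [hV j i hi]) u hu hpack univ x₀
  simp only [hint _ (hf _)] at this
  have hp : ∀ x, ∏ j, ENNReal.ofReal (f j x) ^ u j = ENNReal.ofReal (∏ j, f j x ^ u j) := fun x => by
    rw [ENNReal.ofReal_prod_of_nonneg fun j _ => Real.rpow_nonneg (hf j x) _]
    exact prod_congr rfl fun j _ => ENNReal.ofReal_rpow_of_nonneg (hf j x) (hu j)
  have hs : ∀ j, 0 ≤ (∑ x, f j x) / (Fintype.card X : ℝ) ^ Fintype.card ι := fun j =>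
    div_nonneg (sum_nonneg fun x _ => hf j x) (by positivity)
  simp only [hp] at this
  rw [hint _ fun x => prod_nonneg fun j _ => Real.rpow_nonneg (hf j x) _,
    prod_congr rfl fun j _ => ENNReal.ofReal_rpow_of_nonneg (hs j) (hu j),
    ← ENNReal.ofReal_prod_of_nonneg fun j _ => Real.rpow_nonneg (hs j) _] at this
  exact (ENNReal.ofReal_le_ofReal_iff
    (prod_nonneg fun j _ => Real.rpow_nonneg (hs j) _)).1 this

/-! ### Counting families of permutations -/

theorem card_perm_agree {X : Type*} [Fintype X] [DecidableEq X] (σ₀ : Equiv.Perm X)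
    (s : Finset X) :
    #{σ : Equiv.Perm X | ∀ x ∈ s, σ x = σ₀ x} = (Fintype.card X - #s).factorial := by
  -- Composing with `σ₀⁻¹` reduces to permutations that fix `s` pointwise, that is, permutations of
  -- the complement.
  have e : {σ : Equiv.Perm X // ∀ x ∈ s, σ x = σ₀ x} ≃
      {f : Equiv.Perm X // ∀ a, ¬ a ∉ s → f a = a} :=
    (Equiv.mulLeft σ₀⁻¹).subtypeEquiv fun σ => by
      simp only [not_not, Equiv.coe_mulLeft, Equiv.Perm.coe_mul, Function.comp_apply,
        Equiv.Perm.inv_eq_iff_eq]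
  rw [← Fintype.card_subtype, Fintype.card_congr e,
    ← Fintype.card_congr (Equiv.Perm.subtypeEquivSubtypePerm fun a => a ∉ s), Fintype.card_perm]
  congr 1
  rw [Fintype.card_subtype_compl, Fintype.card_coe]

/-- The matching on the coordinates `V` that is given by the permutations `π v` contains the
restriction of `α` to `V`. -/
def Hits {ι : Type*} {n : ℕ} (V : Finset ι) (π : ι → Equiv.Perm (Fin n)) (α : ι → Fin n) : Prop :=
  ∃ x, ∀ v ∈ V, π v x = α v

section Counting

variable {ι : Type*} [Fintype ι] [DecidableEq ι] {n : ℕ}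

-- The index `x` of the matching tuple is unique since `V` is nonempty, so the `n` events are
-- disjoint; each prescribes one value of `#V` permutations and so has proportion `1 / n ^ #V`.
-- Permutations outside `V` are free: they are kept so that all atoms use the same sample space.
open Classical in
theorem card_hits {V : Finset ι} (hV : V.Nonempty) (α : ι → Fin n) :
    #{π : ι → Equiv.Perm (Fin n) | Hits V π α} * n ^ #V = n * n.factorial ^ Fintype.card ι := by
  have h1 : ({π : ι → Equiv.Perm (Fin n) | Hits V π α} : Finset _) =
      univ.biUnion fun x => Fintype.piFinset fun v =>
        if v ∈ V then ({σ | σ x = α v} : Finset (Equiv.Perm (Fin n))) else univ := by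
    ext π
    simp only [mem_filter, mem_univ, true_and, mem_biUnion, Fintype.mem_piFinset]
    refine exists_congr fun x => forall_congr' fun v => ?_
    by_cases h : v ∈ V <;> simp [h]
  rw [h1, card_biUnion]
  · rw [sum_mul, sum_congr rfl (g := fun _ => n.factorial ^ Fintype.card ι)]
    · simp
    intro x _
    have hnV : n ^ #V = ∏ v, if v ∈ V then n else 1 := by simp
    rw [Fintype.card_piFinset, hnV, ← prod_mul_distrib, ← card_univ, ← prod_const]
    refine prod_congr rfl fun v _ => ?_
    by_cases h : v ∈ V
    · have := card_perm_agree (Equiv.swap x (α v)) {x}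
      simp only [mem_singleton, forall_eq, Equiv.swap_apply_left, card_singleton,
        Fintype.card_fin] at this
      simp only [h, if_true]
      rw [this, mul_comm, Nat.mul_factorial_pred (Fin.pos x).ne']
    · simp [h, Fintype.card_perm]
  · intro x _ y _ hxy
    obtain ⟨v, hv⟩ := hV
    refine disjoint_left.2 fun π hx hy => ?_
    have hx := Fintype.mem_piFinset.1 hx v
    have hy := Fintype.mem_piFinset.1 hy v
    simp only [hv, if_true, mem_filter, mem_univ, true_and] at hx hy
    exact hxy ((π v).injective (hx.trans hy.symm))

/-- If `v₀ ∈ V`, a tuple of a matching is determined by its value at `v₀`. -/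
theorem card_le_of_hits {V : Finset ι} {v₀ : ι} (h₀ : v₀ ∈ V) (π : ι → Equiv.Perm (Fin n))
    (K : Finset (ι → Fin n)) (hK : ∀ α ∈ K, Hits V π α) :
    #K ≤ #(K.image fun α => α v₀) * n ^ (Fintype.card ι - #V) := by
  have hc : Fintype.card ({v // v ∉ V} → Fin n) = n ^ (Fintype.card ι - #V) := by
    rw [Fintype.card_fun, Fintype.card_subtype_compl, Fintype.card_coe, Fintype.card_fin]
  rw [← hc, ← card_univ, ← card_product]
  refine card_le_card_of_injOn (fun α => (α v₀, fun v => α v)) ?_ ?_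
  · intro α hα
    simpa using ⟨α, hα, rfl⟩
  · intro α hα β hβ h
    rw [Prod.mk.injEq] at h
    obtain ⟨x, hx⟩ := hK α hα
    obtain ⟨y, hy⟩ := hK β hβ
    have hxy : x = y := (π v₀).injective (by rw [hx _ h₀, hy _ h₀, h.1])
    ext v
    by_cases hv : v ∈ V
    · rw [← hx v hv, ← hy v hv, hxy]
    · exact congrArg _ (congrFun h.2 ⟨v, hv⟩)

/-- Few families of permutations give matchings that contain a given set of tuples. -/
theorem card_mul_factorial_le_of_hits {V : Finset ι} {v₀ v₁ : ι} (h₀ : v₀ ∈ V) (h₁ : v₁ ∈ V)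
    (hne : v₀ ≠ v₁) (P : Finset (ι → Equiv.Perm (Fin n))) (K : Finset (ι → Fin n))
    (hK : ∀ π ∈ P, ∀ α ∈ K, Hits V π α) :
    #P * n.factorial ≤
      n.factorial ^ Fintype.card ι * (n - #(K.image fun α => α v₀)).factorial := by
  classical
  -- Forget the permutation at `v₁`. Within a fibre `π v₀` is known, so each distinct `v₀`-value of
  -- a tuple in `K` identifies an index at which `π v₁` is prescribed.
  let r : (ι → Equiv.Perm (Fin n)) → ({v // v ≠ v₁} → Equiv.Perm (Fin n)) := fun π v => π v
  have hfib : ∀ b ∈ P.image r, #{π ∈ P | r π = b} ≤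
      (n - #(K.image fun α => α v₀)).factorial := by
    intro b hb
    obtain ⟨π₀, hπ₀, rfl⟩ := mem_image.1 hb
    have hagree := card_perm_agree (π₀ v₁) ((K.image fun α => α v₀).image (π₀ v₀).symm)
    rw [card_image_of_injective _ (π₀ v₀).symm.injective, Fintype.card_fin] at hagree
    rw [← hagree]
    refine card_le_card_of_injOn (fun π => π v₁) ?_ ?_
    · intro π hπ
      obtain ⟨hπP, hπr⟩ := mem_filter.1 hπ
      have hv₀ : π v₀ = π₀ v₀ := congrFun hπr ⟨v₀, hne⟩
      simp only [coe_filter, mem_univ, true_and, Set.mem_ofPred_eq, mem_image]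
      rintro _ ⟨_, ⟨α, hα, rfl⟩, rfl⟩
      obtain ⟨x, hx⟩ := hK π hπP α hα
      obtain ⟨y, hy⟩ := hK π₀ hπ₀ α hα
      have hxy : x = y := (π₀ v₀).injective (by rw [hy _ h₀, ← hv₀, hx _ h₀])
      rw [← hx _ h₀, hv₀, Equiv.symm_apply_apply, hx _ h₁, hxy, hy _ h₁]
    · intro π hπ π' hπ' h
      have hr : r π = r π' := (mem_filter.1 hπ).2.trans (mem_filter.1 hπ').2.symm
      funext v
      by_cases hv : v = v₁
      · exact hv ▸ h
      · exact congrFun hr ⟨v, hv⟩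
  have hc : #(P.image r) ≤ n.factorial ^ (Fintype.card ι - 1) := by
    refine (card_le_univ _).trans_eq ?_
    rw [Fintype.card_fun, Fintype.card_perm, Fintype.card_fin, Fintype.card_subtype_compl,
      Fintype.card_subtype_eq]
  have hpos : Fintype.card ι ≠ 0 := (Fintype.card_pos_iff.2 ⟨v₀⟩).ne'
  calc #P * n.factorial
      ≤ (n - #(K.image fun α => α v₀)).factorial * n.factorial ^ (Fintype.card ι - 1) *
          n.factorial := by
        gcongr
        exact (card_le_mul_card_image P _ hfib).trans (by gcongr)
    _ = _ := by rw [mul_assoc, pow_sub_one_mul hpos, mul_comm]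

end Counting

/-! ### Factorials and numbers of messages -/

theorem factorial_pow_le_factorial_pow {r n : ℕ} (h : r ≤ n) :
    r.factorial ^ n ≤ n.factorial ^ r := by
  induction n, h using Nat.le_induction with
  | base => exact le_rfl
  | succ n hrn ih =>
    rw [pow_succ, Nat.factorial_succ, mul_pow, mul_comm]
    gcongr
    exact r.factorial_le_pow.trans (Nat.pow_le_pow_left (by omega) r)

/-- `log (n - k)! ≤ (1 - k/n) log n!`: each known tuple is worth at least the average `log₂ n! / n`
bits. Measuring in units of `log₂ n!` matches the definition of the input size and holds for every
positive `n`. -/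
theorem two_rpow_mul_factorial_le {k n : ℕ} (h : k ≤ n) (hn : 0 < n) :
    (2 : ℝ) ^ ((k : ℝ) * Real.logb 2 n.factorial / n) * (n - k).factorial ≤ n.factorial := by
  have hn' : (0 : ℝ) < n := by exact_mod_cast hn
  have h1 : (n : ℝ) * Real.logb 2 (n - k).factorial ≤ (n - k : ℕ) * Real.logb 2 n.factorial := by
    rw [← Real.logb_pow, ← Real.logb_pow]
    refine Real.logb_le_logb_of_le one_lt_two (by positivity) ?_
    exact_mod_cast factorial_pow_le_factorial_pow (Nat.sub_le n k)
  rw [Nat.cast_sub h] at h1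
  have hr : ((n - k).factorial : ℝ) = 2 ^ Real.logb 2 (n - k).factorial :=
    (Real.rpow_logb two_pos (by norm_num) (by positivity)).symm
  have hn2 : (n.factorial : ℝ) = 2 ^ Real.logb 2 n.factorial :=
    (Real.rpow_logb two_pos (by norm_num) (by positivity)).symm
  rw [hr, ← Real.rpow_add two_pos]
  conv_rhs => rw [hn2]
  refine Real.rpow_le_rpow_of_exponent_le one_le_two ?_
  rw [div_add' _ _ _ hn'.ne', div_le_iff₀ hn']
  linarith

theorem le_two_rpow (y : ℝ) : y ≤ 2 ^ y := by
  obtain hy | hy := le_or_gt y 0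
  · exact hy.trans (by positivity)
  calc y ≤ (⌊y⌋₊ + 1 : ℕ) := by exact_mod_cast (Nat.lt_floor_add_one y).le
    _ ≤ (2 ^ ⌊y⌋₊ : ℕ) := by exact_mod_cast Nat.lt_two_pow_self
    _ = (2 : ℝ) ^ (⌊y⌋₊ : ℝ) := by rw [Real.rpow_natCast]; norm_cast
    _ ≤ 2 ^ y := Real.rpow_le_rpow_of_exponent_le one_le_two (Nat.floor_le hy.le)

/-- There are fewer than `2 ^ (L + 1)` bit strings of length at most `L`. -/
theorem exists_finset_length_le (L : ℕ) :
    ∃ S : Finset (List Bool), (∀ l : List Bool, l.length ≤ L → l ∈ S) ∧ #S ≤ 2 ^ (L + 1) := by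
  refine ⟨(range (L + 1)).biUnion fun k => univ.image (List.ofFn : (Fin k → Bool) → List Bool),
    fun l hl => ?_, ?_⟩
  · exact mem_biUnion.2 ⟨l.length, mem_range.2 (by omega), mem_image.2 ⟨l.get, mem_univ _, by simp⟩⟩
  · refine card_biUnion_le.trans ((sum_le_sum fun k _ => card_image_le).trans ?_)
    simp only [card_univ, Fintype.card_fun, Fintype.card_bool, Fintype.card_fin]
    rw [Nat.geomSum_eq le_rfl]
    simp

/-! ### What a short message reveals about a matching -/

/-- The message `m π` determines that the matching contains the restriction of `α` to `V`. -/
def Knows {ι M : Type*} {n : ℕ} (m : (ι → Equiv.Perm (Fin n)) → M) (V : Finset ι)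
    (π : ι → Equiv.Perm (Fin n)) (α : ι → Fin n) : Prop :=
  ∀ π', m π' = m π → Hits V π' α

theorem Knows.hits {ι M : Type*} {n : ℕ} {m : (ι → Equiv.Perm (Fin n)) → M} {V : Finset ι}
    {π : ι → Equiv.Perm (Fin n)} {α : ι → Fin n} (h : Knows m V π α) : Hits V π α :=
  h π rfl

section Knowledge

variable {ι : Type*} [Fintype ι] [DecidableEq ι] {n : ℕ}

-- Inputs with the same message share the same known tuples, so a message revealing many of them has
-- few preimages. This bounds an exponential moment of the number of known `v₀`-values, hence its
-- mean.
open Classical in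
theorem sum_card_knows_image_le (m : (ι → Equiv.Perm (Fin n)) → List Bool) {V : Finset ι}
    {v₀ v₁ : ι} (h₀ : v₀ ∈ V) (h₁ : v₁ ∈ V) (hne : v₀ ≠ v₁) (hn : 2 ≤ n) (L : ℕ) :
    ∑ π with (m π).length ≤ L,
        (#(({α | Knows m V π α} : Finset (ι → Fin n)).image fun α => α v₀) : ℝ) ≤
      (n.factorial : ℝ) ^ Fintype.card ι * ((L + 2) * n / Real.logb 2 n.factorial) := by
  set κ : (ι → Equiv.Perm (Fin n)) → ℕ :=
    fun π => #(({α | Knows m V π α} : Finset (ι → Fin n)).image fun α => α v₀) with hκ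
  set b := Real.logb 2 n.factorial with hb
  have hn0 : (0 : ℝ) < n := by positivity
  have hb0 : 0 < b := Real.logb_pos one_lt_two (by
    exact_mod_cast (by norm_num : 1 < 2).trans_le (Nat.self_le_factorial 2 |>.trans
      (Nat.factorial_le hn)))
  have hκn : ∀ π, κ π ≤ n := fun π => (card_le_univ _).trans_eq (Fintype.card_fin n)
  obtain ⟨S, hS, hScard⟩ := exists_finset_length_le L
  -- Each message contributes at most `n! ^ k`, where `k` is the number of coordinates, since the
  -- weight `2 ^ (κ b / n)` is at most `n! / (n - κ)!`, exactly what the size of the fibre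
  -- compensates.
  have hexp : ∑ π with (m π).length ≤ L, (2 : ℝ) ^ (κ π * b / n) ≤
      2 ^ (L + 1) * (n.factorial : ℝ) ^ Fintype.card ι := by
    rw [← sum_fiberwise_of_maps_to (t := S) (g := m) fun π hπ => hS _ (mem_filter.1 hπ).2]
    have hfib : ∀ μ ∈ S, ∑ π ∈ ({π | (m π).length ≤ L} : Finset _) with m π = μ,
        (2 : ℝ) ^ (κ π * b / n) ≤ (n.factorial : ℝ) ^ Fintype.card ι := by
      intro μ _
      set P := ({π ∈ ({π | (m π).length ≤ L} : Finset (ι → Equiv.Perm (Fin n))) | m π = μ}) with hP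
      obtain hPe | ⟨π₀, hπ₀⟩ := P.eq_empty_or_nonempty
      · rw [hPe]; simp
      have hmP : ∀ π ∈ P, m π = m π₀ := fun π hπ =>
        (mem_filter.1 hπ).2.trans (mem_filter.1 hπ₀).2.symm
      have hκP : ∀ π ∈ P, κ π = κ π₀ := fun π hπ => by
        have : Knows m V π = Knows m V π₀ := by
          funext α
          simp only [Knows, hmP π hπ]
        simp only [hκ, this]
      have hcount := card_mul_factorial_le_of_hits h₀ h₁ hne P {α | Knows m V π₀ α}
        fun π hπ α hα => (mem_filter.1 hα).2 π (hmP π hπ)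
      rw [sum_congr rfl fun π hπ => by rw [hκP π hπ], sum_const, nsmul_eq_mul]
      have h2 := two_rpow_mul_factorial_le (hκn π₀) (by omega)
      rw [← hb] at h2
      have hcount' : (#P : ℝ) * n.factorial ≤
          (n.factorial : ℝ) ^ Fintype.card ι * (n - κ π₀).factorial := by exact_mod_cast hcount
      have hfp : (0 : ℝ) < (n - κ π₀).factorial := by positivity
      refine le_of_mul_le_mul_right ?_ hfp
      calc (#P : ℝ) * 2 ^ (κ π₀ * b / n) * (n - κ π₀).factorial
          = #P * (2 ^ (κ π₀ * b / n) * (n - κ π₀).factorial) := by ring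
        _ ≤ #P * n.factorial := by gcongr
        _ ≤ _ := hcount'
    refine (sum_le_sum hfib).trans ?_
    rw [sum_const, nsmul_eq_mul]
    gcongr
    exact_mod_cast hScard
  -- `y ≤ 2 ^ y` shifted by `L + 1`. The shift absorbs the number of messages, so the exponential
  -- term averages to at most 1; together they give `L + 2`.
  have hlin : ∀ y : ℝ, y ≤ L + 1 + 2 ^ y / 2 ^ (L + 1) := fun y => by
    have h1 := le_two_rpow (y - (L + 1))
    have h2 : (2 : ℝ) ^ (y - (L + 1)) = 2 ^ y / 2 ^ (L + 1) := by
      rw [Real.rpow_sub two_pos, ← Nat.cast_succ, Real.rpow_natCast]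
    linarith
  have hcardle : (#{π : ι → Equiv.Perm (Fin n) | (m π).length ≤ L} : ℝ) ≤
      (n.factorial : ℝ) ^ Fintype.card ι := by
    have := card_le_univ ({π | (m π).length ≤ L} : Finset (ι → Equiv.Perm (Fin n)))
    rw [Fintype.card_fun, Fintype.card_perm, Fintype.card_fin] at this
    exact_mod_cast this
  have hsum : ∑ π with (m π).length ≤ L, (κ π : ℝ) * b / n ≤
      (n.factorial : ℝ) ^ Fintype.card ι * (L + 2) := by
    refine (sum_le_sum fun π _ => hlin _).trans ?_
    rw [sum_add_distrib, sum_const, nsmul_eq_mul, ← sum_div]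
    calc _ ≤ (n.factorial : ℝ) ^ Fintype.card ι * (L + 1) +
          2 ^ (L + 1) * (n.factorial : ℝ) ^ Fintype.card ι / 2 ^ (L + 1) := by gcongr
      _ = _ := by field_simp; ring
  calc ∑ π with (m π).length ≤ L, (κ π : ℝ)
      = (∑ π with (m π).length ≤ L, (κ π : ℝ) * b / n) * (n / b) := by
        rw [sum_mul]
        exact sum_congr rfl fun π _ => by field_simp
    _ ≤ (n.factorial : ℝ) ^ Fintype.card ι * (L + 2) * (n / b) := by gcongr
    _ = _ := by ring

-- Double counting of pairs `(π, α)`. A known tuple is determined on `V` by its `v₀`-value and is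
-- free off `V`, whence the factor `n ^ (k - #V)` with `k` the number of coordinates. Two variables
-- in `V` are needed: one to identify the index, one whose permutation carries the information.
open Classical in
theorem sum_card_knows_le (m : (ι → Equiv.Perm (Fin n)) → List Bool) {V : Finset ι}
    (hV : 2 ≤ #V) (hn : 2 ≤ n) (L : ℕ) :
    ∑ α, (#{π | (m π).length ≤ L ∧ Knows m V π α} : ℝ) ≤
      (n.factorial : ℝ) ^ Fintype.card ι * ((L + 2) * n / Real.logb 2 n.factorial) *
        n ^ (Fintype.card ι - #V) := by
  obtain ⟨v₀, h₀, v₁, h₁, hne⟩ := one_lt_card.1 hV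
  calc ∑ α, (#{π | (m π).length ≤ L ∧ Knows m V π α} : ℝ)
      = ∑ π with (m π).length ≤ L, (#({α | Knows m V π α} : Finset (ι → Fin n)) : ℝ) := by
        simp only [card_filter, Nat.cast_sum]
        rw [sum_comm, sum_filter]
        refine sum_congr rfl fun π _ => ?_
        by_cases h : (m π).length ≤ L <;> simp [h]
    _ ≤ ∑ π with (m π).length ≤ L,
        (#(({α | Knows m V π α} : Finset (ι → Fin n)).image fun α => α v₀) : ℝ) *
          n ^ (Fintype.card ι - #V) := by
        refine sum_le_sum fun π _ => ?_
        exact_mod_cast card_le_of_hits h₀ π _ fun α hα => Knows.hits (mem_filter.1 hα).2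
    _ ≤ _ := by
        rw [← sum_mul]
        gcongr
        exact sum_card_knows_image_le m h₀ h₁ hne hn L

end Knowledge

/-! ### Combining the atoms; averaging arguments -/

/-- A consequence of Finner's inequality: the sum of a product of functions that are bounded
pointwise and on average is small. -/
theorem sum_prod_le_of_packing {ι κ X : Type*} [Fintype ι] [DecidableEq ι] [Fintype κ]
    [Fintype X] [Nonempty X] (V : κ → Finset ι) (hne : ∀ j, (V j).Nonempty)
    (W : κ → (ι → X) → ℝ) (hW : ∀ j x, 0 ≤ W j x)
    (hV : ∀ j, ∀ i ∉ V j, ∀ x y, W j (Function.update x i y) = W j x)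
    (u : κ → ℝ) (hu : ∀ j, 0 ≤ u j) (hpack : ∀ i, ∑ j with i ∈ V j, u j ≤ 1)
    (h : κ → ℝ) (hh : ∀ j, 0 < h j) (hWh : ∀ j x, W j x ≤ h j) {β : ℝ} (hβ : 0 ≤ β)
    (hsum : ∀ j, ∑ x, W j x ≤ β * h j * (Fintype.card X : ℝ) ^ Fintype.card ι) :
    ∑ x, ∏ j, W j x ≤ β ^ (∑ j, u j) * ((Fintype.card X : ℝ) ^ Fintype.card ι * ∏ j, h j) := by
  have hu1 : ∀ j, u j ≤ 1 := fun j => by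
    obtain ⟨i, hi⟩ := hne j
    exact (single_le_sum (f := u) (fun j _ => hu j) (by simpa using hi)).trans (hpack i)
  have hN : (0 : ℝ) < (Fintype.card X : ℝ) ^ Fintype.card ι := by positivity
  have hg : ∀ j x, 0 ≤ W j x / h j := fun j x => div_nonneg (hW j x) (hh j).le
  have key := sum_prod_rpow_div_le V (fun j x => W j x / h j) hg
    (fun j i hi x y => by rw [hV j i hi]) u hu hpack
  rw [div_le_iff₀ hN] at key
  calc ∑ x, ∏ j, W j x = (∏ j, h j) * ∑ x, ∏ j, W j x / h j := by
        rw [mul_sum]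
        refine sum_congr rfl fun x _ => ?_
        rw [← prod_mul_distrib]
        exact prod_congr rfl fun j _ => by rw [mul_div_cancel₀ _ (hh j).ne']
    -- The normalized functions lie in `[0, 1]` and the packing weights are at most 1, so raising to
    -- the power `u j` only increases them.
    _ ≤ (∏ j, h j) * ∑ x, ∏ j, (W j x / h j) ^ u j := by
        have := prod_nonneg fun j (_ : j ∈ univ) => (hh j).le
        gcongr with x _ j _
        · intro j _; exact hg j x
        · exact Real.self_le_rpow_of_le_one (hg j x) ((div_le_one (hh j)).2 (hWh j x)) (hu1 j)
    _ ≤ (∏ j, h j) * ((∏ j, ((∑ x, W j x / h j) / (Fintype.card X : ℝ) ^ Fintype.card ι) ^ u j) *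
          (Fintype.card X : ℝ) ^ Fintype.card ι) := by
        have := prod_nonneg fun j (_ : j ∈ univ) => (hh j).le
        gcongr
    _ ≤ (∏ j, h j) * ((∏ j, β ^ u j) * (Fintype.card X : ℝ) ^ Fintype.card ι) := by
        have := prod_nonneg fun j (_ : j ∈ univ) => (hh j).le
        have h0 : ∀ j, 0 ≤ (∑ x, W j x / h j) / (Fintype.card X : ℝ) ^ Fintype.card ι :=
          fun j => div_nonneg (sum_nonneg fun x _ => hg j x) hN.le
        gcongr with j _
        · intro j _; exact Real.rpow_nonneg (h0 j) _
        · exact h0 j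
        · exact hu j
        · rw [← sum_div, div_div, div_le_iff₀ (mul_pos (hh j) hN)]
          exact (hsum j).trans_eq (by ring)
    _ = _ := by
        rw [← Real.rpow_sum_of_nonneg hβ fun j _ => hu j]
        ring

theorem card_forall_eq_prod {ι X : Type*} [Fintype ι] [DecidableEq ι] [Fintype X]
    (P : ι → X → Prop) [DecidablePred fun w : ι → X => ∀ j, P j (w j)]
    [∀ j, DecidablePred (P j)] : #{w : ι → X | ∀ j, P j (w j)} = ∏ j, #{π | P j π} := by
  rw [← Fintype.card_piFinset]
  congr 1
  ext w
  simp

/-- Linearity of expectation together with the independence of the components of `w`, in counting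
form. -/
theorem sum_card_forall_eq {ι X Y : Type*} [Fintype ι] [DecidableEq ι] [Fintype X] [Fintype Y]
    (P : ι → X → Y → Prop) [∀ w : ι → X, DecidablePred fun α => ∀ j, P j (w j) α]
    [∀ j α, DecidablePred fun π => P j π α] :
    ∑ w : ι → X, (#{α | ∀ j, P j (w j) α} : ℝ) = ∑ α, ∏ j, (#{π | P j π α} : ℝ) := by
  classical
  simp only [← Nat.cast_prod, ← Nat.cast_sum]
  congr 1
  rw [sum_congr rfl fun α _ => (card_forall_eq_prod fun j π => P j π α).symm]
  simp only [card_filter]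
  rw [sum_comm]

theorem card_le_sum_card_of_forall_exists {X Y : Type*} [DecidableEq X] [Fintype Y]
    (s : Finset X) (t : Y → Finset X) (h : ∀ x ∈ s, ∃ y, x ∈ t y) : #s ≤ ∑ y, #(t y) :=
  (card_le_card fun x hx => by simpa using h x hx).trans card_biUnion_le

/-- If every point lies in a fraction `r` of finitely many (not necessarily measurable) sets, then
one of them has measure at least `r`. -/
theorem exists_le_measureReal {Ω W : Type*} [MeasurableSpace Ω] (μ : Measure Ω)
    [IsProbabilityMeasure μ] [Fintype W] [Nonempty W] (F : W → Set Ω) (r : ℝ)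
    [∀ ω, DecidablePred fun w => ω ∈ F w]
    (hF : ∀ ω, r * Fintype.card W ≤ #{w | ω ∈ F w}) : ∃ w, r ≤ μ.real (F w) := by
  by_contra! hcon
  have h1 : ∑ w, μ.real (F w) < r * Fintype.card W := by
    refine (sum_lt_sum_of_nonempty univ_nonempty fun w _ => hcon w).trans_eq ?_
    simp [mul_comm]
  -- The sets need not be measurable, so each is replaced by a measurable hull of the same measure,
  -- and the hulls are averaged.
  have h2 : ∀ w, μ.real (F w) = ∫ ω, (toMeasurable μ (F w)).indicator (fun _ => (1 : ℝ)) ω ∂μ :=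
    fun w => by
      rw [integral_indicator_const _ (measurableSet_toMeasurable _ _), smul_eq_mul, mul_one,
        Measure.real, Measure.real, measure_toMeasurable]
  have hi : ∀ w ∈ (univ : Finset W),
      Integrable ((toMeasurable μ (F w)).indicator fun _ => (1 : ℝ)) μ :=
    fun w _ => (integrable_const _).indicator (measurableSet_toMeasurable _ _)
  simp only [h2] at h1
  rw [← integral_finsetSum _ hi] at h1
  refine h1.not_ge ?_
  calc r * Fintype.card W = ∫ _, r * Fintype.card W ∂μ := by simp
    _ ≤ _ := by
      refine integral_mono (integrable_const _) (integrable_finsetSum _ hi) fun ω => ?_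
      refine (hF ω).trans ?_
      rw [card_filter, Nat.cast_sum]
      refine sum_le_sum fun w _ => ?_
      by_cases hw : ω ∈ F w
      · simp [hw, subset_toMeasurable μ (F w) hw]
      · simp only [hw, if_false, Nat.cast_zero]
        exact Set.indicator_nonneg (fun _ _ => zero_le_one) _

/-! ### Matching databases from permutations -/

namespace ConjunctiveQuery

variable {q : ConjunctiveQuery} {n : ℕ}

/-- The matching given by a family of permutations, with equal columns for equal variables. -/
def matchingOf (q : ConjunctiveQuery) (j : Fin q.numAtoms)
    (π : Fin q.numVars → Equiv.Perm (Fin n)) : Finset (Tup (q.arity j) n) :=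
  univ.image fun x m => π (q.atom j m) x

theorem isMatchingRelation_matchingOf (j : Fin q.numAtoms)
    (π : Fin q.numVars → Equiv.Perm (Fin n)) : IsMatchingRelation (q.matchingOf j π) := by
  refine ⟨?_, fun m => ⟨fun _ _ => trivial, ?_, fun y _ => ?_⟩⟩
  · rw [matchingOf, card_image_of_injective, card_univ, Fintype.card_fin]
    intro x y h
    exact (π (q.atom j ⟨0, q.arity_pos j⟩)).injective (congrFun h ⟨0, q.arity_pos j⟩)
  · intro t ht t' ht' h
    obtain ⟨x, -, rfl⟩ := mem_image.1 (mem_coe.1 ht)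
    obtain ⟨y, -, rfl⟩ := mem_image.1 (mem_coe.1 ht')
    rw [(π (q.atom j m)).injective h]
  · exact ⟨_, mem_coe.2 (mem_image_of_mem _ (mem_univ ((π (q.atom j m)).symm y))), by simp⟩

theorem mem_matchingOf_iff {j : Fin q.numAtoms} {π : Fin q.numVars → Equiv.Perm (Fin n)}
    {α : Tup q.numVars n} :
    (fun m => α (q.atom j m)) ∈ q.matchingOf j π ↔ Hits (q.vars j) π α := by
  simp only [matchingOf, mem_image, mem_univ, true_and, Hits, vars, funext_iff,
    forall_exists_index, forall_apply_eq_imp_iff]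

/-- The matching database given by a family of permutations for each atom. -/
def databaseOf (w : Fin q.numAtoms → Fin q.numVars → Equiv.Perm (Fin n)) : q.Database n :=
  fun j => q.matchingOf j (w j)

theorem isMatchingDatabase_databaseOf
    (w : Fin q.numAtoms → Fin q.numVars → Equiv.Perm (Fin n)) :
    q.IsMatchingDatabase (databaseOf w) :=
  fun j => isMatchingRelation_matchingOf j (w j)

theorem mem_answers_databaseOf {w : Fin q.numAtoms → Fin q.numVars → Equiv.Perm (Fin n)}
    {α : Tup q.numVars n} :
    α ∈ q.answers (databaseOf w) ↔ ∀ j, Hits (q.vars j) (w j) α :=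
  forall_congr' fun _ => mem_matchingOf_iff

/-- In a connected query, an answer on a matching database is determined by each of its
values. -/
theorem injOn_answers (hconn : q.IsConnected) {I : q.Database n} (hI : q.IsMatchingDatabase I)
    (i₀ : Fin q.numVars) : Set.InjOn (fun α : Tup q.numVars n => α i₀) (q.answers I) := by
  intro α hα β hβ h
  funext i
  obtain ⟨p⟩ := hconn.preconnected i₀ i
  induction p with
  | nil => exact h
  | cons hadj p ih =>
    -- Adjacent variables share an atom, and in a matching the value in one column determines the
    -- tuple, so equality propagates along the path.
    refine ih ?_
    obtain ⟨-, j, hx, hy⟩ := hadj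
    obtain ⟨m, -, rfl⟩ := mem_image.1 hx
    obtain ⟨m', -, rfl⟩ := mem_image.1 hy
    exact congrFun (((hI j).2 m).injOn (hα j) (hβ j) h) m'

open Classical in
theorem card_answers_le (hconn : q.IsConnected) {I : q.Database n}
    (hI : q.IsMatchingDatabase I) : #{α | α ∈ q.answers I} ≤ n := by
  obtain ⟨i₀⟩ := hconn.nonempty
  refine (card_le_card_of_injOn (t := univ) (fun α => α i₀) (fun _ _ => mem_univ _) ?_).trans_eq
    (by simp)
  intro α hα β hβ h
  exact injOn_answers hconn hI i₀ (by simpa using hα) (by simpa using hβ) h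

/-- The number of families of permutations whose matching contains a given tuple of `S_j`. -/
noncomputable def hitCount (q : ConjunctiveQuery) (n : ℕ) (j : Fin q.numAtoms) : ℝ :=
  n * (n.factorial : ℝ) ^ q.numVars / (n : ℝ) ^ #(q.vars j)

open Classical in
theorem card_hits_eq_hitCount (hn : 0 < n) (j : Fin q.numAtoms) (α : Tup q.numVars n) :
    (#{π : Fin q.numVars → Equiv.Perm (Fin n) | Hits (q.vars j) π α} : ℝ) = q.hitCount n j := by
  have hn' : (0 : ℝ) < n := by exact_mod_cast hn
  have := card_hits (q.vars_nonempty j) α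
  rw [Fintype.card_fin] at this
  rw [hitCount, eq_div_iff (by positivity)]
  exact_mod_cast this

theorem hitCount_pos (hn : 0 < n) (j : Fin q.numAtoms) : 0 < q.hitCount n j := by
  have hn' : (0 : ℝ) < n := by exact_mod_cast hn
  rw [hitCount]
  positivity

open Classical in
theorem sum_card_answers (hn : 0 < n) :
    ∑ w : Fin q.numAtoms → Fin q.numVars → Equiv.Perm (Fin n),
      (#{α | α ∈ q.answers (databaseOf w)} : ℝ) = (n : ℝ) ^ q.numVars * ∏ j, q.hitCount n j := by
  simp only [mem_answers_databaseOf]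
  rw [sum_card_forall_eq fun j π α => Hits (q.vars j) π α,
    sum_congr rfl fun α _ => prod_congr rfl fun j _ => card_hits_eq_hitCount hn j α]
  simp

end ConjunctiveQuery

/-! ### The lower bound -/

namespace OneRoundAlgorithm

open ConjunctiveQuery

variable {q : ConjunctiveQuery} {n p : ℕ}

/-- Replacing only `S_j` by another matching with the same message leaves everything that worker `u`
receives unchanged. It still reports `α`, and soundness on the new input puts the restriction of `α`
into the new `S_j`. -/
theorem IsSound.knows {A : OneRoundAlgorithm q n p} (hA : A.IsSound)
    {w : Fin q.numAtoms → Fin q.numVars → Equiv.Perm (Fin n)} {u : Fin p} {α : Tup q.numVars n}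
    (hα : α ∈ A.report u fun j => A.message j u (databaseOf w j)) (j : Fin q.numAtoms) :
    Knows (fun π => A.message j u (q.matchingOf j π)) (q.vars j) (w j) α := by
  intro π' hπ'
  have hmsg : (fun j' => A.message j' u (databaseOf (Function.update w j π') j')) =
      fun j' => A.message j' u (databaseOf w j') := by
    funext j'
    by_cases h : j' = j
    · subst h
      simpa [databaseOf] using hπ'
    · simp [databaseOf, h]
  have := hA _ (isMatchingDatabase_databaseOf (Function.update w j π'))
    (Set.mem_iUnion.2 ⟨u, hmsg ▸ hα⟩)
  simpa using mem_answers_databaseOf.1 this j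

open Classical in
/-- On the inputs where it does not fail, a sound algorithm finds few answers. -/
theorem sum_card_answers_not_fails_le {A : OneRoundAlgorithm q n p} (hA : A.IsSound)
    (hvars : ∀ j, 2 ≤ #(q.vars j)) (hn : 2 ≤ n) {L : ℝ} (j₀ : Fin q.numAtoms) :
    ∑ w : Fin q.numAtoms → Fin q.numVars → Equiv.Perm (Fin n) with ¬ A.Fails L (databaseOf w),
        (#{α | α ∈ q.answers (databaseOf w)} : ℝ) ≤
      p * ((⌊L⌋₊ + 2) / Real.logb 2 n.factorial) ^ q.fractionalCoveringNumber *
        ((n : ℝ) ^ q.numVars * ∏ j, q.hitCount n j) := by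
  have : Nonempty (Fin n) := ⟨⟨0, by omega⟩⟩
  have hn0 : (0 : ℝ) < n := by positivity
  set W : Fin p → Fin q.numAtoms → Tup q.numVars n → ℕ := fun u j α =>
    #{π | (A.message j u (q.matchingOf j π)).length ≤ ⌊L⌋₊ ∧
      Knows (fun π => A.message j u (q.matchingOf j π)) (q.vars j) π α} with hWdef
  obtain ⟨e, he0, hepack, hesum⟩ := q.exists_packing_eq_fractionalCoveringNumber j₀
  have hworker : ∀ u, ∑ α, ∏ j, (W u j α : ℝ) ≤
      ((⌊L⌋₊ + 2) / Real.logb 2 n.factorial) ^ q.fractionalCoveringNumber *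
        ((n : ℝ) ^ q.numVars * ∏ j, q.hitCount n j) := fun u => by
    have hb : 0 ≤ Real.logb 2 n.factorial :=
      Real.logb_nonneg one_lt_two (by exact_mod_cast n.factorial_pos)
    have := sum_prod_le_of_packing q.vars q.vars_nonempty (fun j α => (W u j α : ℝ))
      (fun _ _ => Nat.cast_nonneg _) ?_ e he0 hepack (q.hitCount n)
      (hitCount_pos (by omega)) ?_ (β := (⌊L⌋₊ + 2) / Real.logb 2 n.factorial)
      (by positivity) ?_
    · rwa [hesum, Fintype.card_fin, Fintype.card_fin] at this
    · intro j i hi α y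
      have : ∀ π, Hits (q.vars j) π (Function.update α i y) ↔ Hits (q.vars j) π α := fun π => by
        refine exists_congr fun x => forall₂_congr fun v hv => ?_
        have hvi : v ≠ i := fun h => hi (h ▸ hv)
        rw [Function.update_of_ne hvi]
      exact congrArg _ (congrArg card (filter_congr fun π _ => by simp only [Knows, this]))
    · intro j α
      rw [← card_hits_eq_hitCount (by omega) j α]
      exact_mod_cast card_le_card fun π hπ => by
        simp only [mem_filter, mem_univ, true_and] at hπ ⊢
        exact Knows.hits hπ.2
    · intro j
      refine (sum_card_knows_le (fun π => A.message j u (q.matchingOf j π)) (hvars j) hn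
        ⌊L⌋₊).trans_eq ?_
      have hd : #(q.vars j) ≤ q.numVars := by simpa using card_le_univ (q.vars j)
      rw [hitCount, Fintype.card_fin, Fintype.card_fin, pow_sub₀ _ hn0.ne' hd]
      ring
  have hcover : ∀ w : Fin q.numAtoms → Fin q.numVars → Equiv.Perm (Fin n),
      ¬ A.Fails L (databaseOf w) → ∀ α ∈ q.answers (databaseOf w), ∃ u, ∀ j,
        (A.message j u (q.matchingOf j (w j))).length ≤ ⌊L⌋₊ ∧
        Knows (fun π => A.message j u (q.matchingOf j π)) (q.vars j) (w j) α := by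
    intro w hw α hα
    simp only [Fails, not_or, not_exists, not_lt, ne_eq, not_not] at hw
    rw [← hw.2] at hα
    obtain ⟨u, hu⟩ := Set.mem_iUnion.1 hα
    refine ⟨u, fun j => ⟨?_, hA.knows hu j⟩⟩
    refine (single_le_sum (f := fun j => (A.message j u (databaseOf w j)).length)
      (fun _ _ => Nat.zero_le _) (mem_univ j)).trans (Nat.le_floor (hw.1 u))
  calc _ ≤ ∑ w : Fin q.numAtoms → Fin q.numVars → Equiv.Perm (Fin n), ∑ u : Fin p,
        (#{α | ∀ j, (A.message j u (q.matchingOf j (w j))).length ≤ ⌊L⌋₊ ∧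
        Knows (fun π => A.message j u (q.matchingOf j π)) (q.vars j) (w j) α} : ℝ) := by
        refine (sum_le_sum fun w hw => ?_).trans
          (sum_le_sum_of_subset_of_nonneg (filter_subset _ _) fun _ _ _ =>
            sum_nonneg fun _ _ => Nat.cast_nonneg _)
        rw [← Nat.cast_sum]
        refine Nat.cast_le.2 (card_le_sum_card_of_forall_exists _ _ fun α hα => ?_)
        obtain ⟨u, hu⟩ := hcover w (mem_filter.1 hw).2 α (mem_filter.1 hα).2
        exact ⟨u, mem_filter.2 ⟨mem_univ α, hu⟩⟩
    _ = ∑ u : Fin p, ∑ α, ∏ j, (W u j α : ℝ) := by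
        rw [sum_comm]
        refine sum_congr rfl fun u _ => ?_
        exact sum_card_forall_eq fun j π α =>
          (A.message j u (q.matchingOf j π)).length ≤ ⌊L⌋₊ ∧
            Knows (fun π => A.message j u (q.matchingOf j π)) (q.vars j) π α
    _ ≤ ∑ u : Fin p, _ := sum_le_sum fun u _ => hworker u
    _ = _ := by
        rw [sum_const, card_univ, Fintype.card_fin, nsmul_eq_mul]
        ring

open Classical in
/-- An algorithm that sends no messages finds few answers on the inputs where it does not
fail. -/
theorem sum_card_answers_not_fails_le_of_lt_one {A : OneRoundAlgorithm q n p}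
    (hconn : q.IsConnected) (hvars : ∀ j, 2 ≤ #(q.vars j)) (hn : 2 ≤ n) {L : ℝ} (hL : L < 1)
    (j₀ : Fin q.numAtoms) :
    ∑ w : Fin q.numAtoms → Fin q.numVars → Equiv.Perm (Fin n) with ¬ A.Fails L (databaseOf w),
        (#{α | α ∈ q.answers (databaseOf w)} : ℝ) ≤
      1 / 2 * ((n : ℝ) ^ q.numVars * ∏ j, q.hitCount n j) := by
  have hprod : 0 < ∏ j, q.hitCount n j := prod_pos fun j _ => hitCount_pos (by omega) j
  -- Loads are integers, so below the limit `L < 1` all messages are empty, and the output is the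
  -- same on all inputs without failure.
  have hout : ∀ w w' : Fin q.numAtoms → Fin q.numVars → Equiv.Perm (Fin n),
      ¬ A.Fails L (databaseOf w) → ¬ A.Fails L (databaseOf w') →
        q.answers (databaseOf w) = q.answers (databaseOf w') := by
    have hnil : ∀ w : Fin q.numAtoms → Fin q.numVars → Equiv.Perm (Fin n),
        ¬ A.Fails L (databaseOf w) → ∀ j u, A.message j u (databaseOf w j) = [] := by
      intro w hw j u
      simp only [Fails, not_or, not_exists, not_lt] at hw
      have h0 : A.bitsReceived (databaseOf w) u < 1 := by exact_mod_cast (hw.1 u).trans_lt hL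
      rw [Nat.lt_one_iff, bitsReceived, sum_eq_zero_iff] at h0
      exact List.length_eq_zero_iff.1 (h0 j (mem_univ j))
    intro w w' hw hw'
    have h1 := hnil w hw
    have h2 := hnil w' hw'
    simp only [Fails, not_or, ne_eq, not_not] at hw hw'
    rw [← hw.2, ← hw'.2]
    simp only [output, h1, h2]
  by_cases hex : ∃ w₀ : Fin q.numAtoms → Fin q.numVars → Equiv.Perm (Fin n),
      ¬ A.Fails L (databaseOf w₀) ∧ ∃ α, α ∈ q.answers (databaseOf w₀)
  · obtain ⟨w₀, hw₀, α, hα⟩ := hex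
    have hk : 2 ≤ q.numVars := (hvars j₀).trans (by simpa using card_le_univ (q.vars j₀))
    calc _ ≤ ∑ w : Fin q.numAtoms → Fin q.numVars → Equiv.Perm (Fin n) with
          ¬ A.Fails L (databaseOf w), (n : ℝ) :=
          sum_le_sum fun w _ => by
            exact_mod_cast card_answers_le hconn (isMatchingDatabase_databaseOf w)
      _ ≤ (∏ j, q.hitCount n j) * n := by
          rw [sum_const, nsmul_eq_mul]
          gcongr
          -- All inputs without failure have the common answer `α`, so there are at most `∏ j,
          -- q.hitCount n j` of them.
          rw [← prod_congr rfl fun j _ => card_hits_eq_hitCount (by omega) j α, ← Nat.cast_prod,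
            ← card_forall_eq_prod fun j π => Hits (q.vars j) π α]
          refine Nat.cast_le.2 (card_le_card fun w hw => ?_)
          simp only [mem_filter, mem_univ, true_and] at hw ⊢
          rw [hout w₀ w hw₀ hw] at hα
          exact mem_answers_databaseOf.1 hα
      _ ≤ (∏ j, q.hitCount n j) * (1 / 2 * (n : ℝ) ^ q.numVars) := by
          gcongr
          have hn' : (2 : ℝ) ≤ n := by exact_mod_cast hn
          have := pow_le_pow_right₀ (by linarith : (1 : ℝ) ≤ n) hk
          nlinarith
      _ = _ := by ring
  · push Not at hex
    rw [sum_eq_zero fun w hw => ?_]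
    · positivity
    · rw [Nat.cast_eq_zero, card_eq_zero, filter_eq_empty_iff]
      exact fun α _ => hex w (mem_filter.1 hw).2 α

-- Inputs without failure account for at most half of the total number of answers, and each failing
-- input for at most `n`. Dividing the remaining half by `n` leaves the proportion `n ^ χ / 2`.
open Classical in
theorem le_card_fails {A : OneRoundAlgorithm q n p} (hA : A.IsSound) (hconn : q.IsConnected)
    (hvars : ∀ j, 2 ≤ #(q.vars j)) (hn : 2 ≤ n) (j₀ : Fin q.numAtoms) {ε c : ℝ}
    (hp : 0 < p)
    (hsmall : p * (3 * c * (∑ j, ((q.arity j : ℝ) - 1)) / (p : ℝ) ^ (1 - ε)) ^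
      q.fractionalCoveringNumber ≤ 1 / 2) :
    1 / 2 * (n : ℝ) ^ q.characteristic *
        Fintype.card (Fin q.numAtoms → Fin q.numVars → Equiv.Perm (Fin n)) ≤
      #{w : Fin q.numAtoms → Fin q.numVars → Equiv.Perm (Fin n) |
        A.Fails (q.loadLimit n p ε c) (databaseOf w)} := by
  set L := q.loadLimit n p ε c with hL
  set E := (n : ℝ) ^ q.numVars * ∏ j, q.hitCount n j with hE
  have hp' : (0 : ℝ) < p := by exact_mod_cast hp
  have hn' : (2 : ℝ) ≤ n := by exact_mod_cast hn
  have hn0 : (0 : ℝ) < n := by linarith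
  have hE0 : 0 < E := mul_pos (by positivity) (prod_pos fun j _ => hitCount_pos (by omega) j)
  have hτ := q.one_le_fractionalCoveringNumber j₀
  have hgood : ∑ w : Fin q.numAtoms → Fin q.numVars → Equiv.Perm (Fin n) with
      ¬ A.Fails L (databaseOf w), (#{α | α ∈ q.answers (databaseOf w)} : ℝ) ≤ 1 / 2 * E := by
    -- The constant 3 in `hsmall` comes from `⌊L⌋ + 2 ≤ 3 L`, which needs `L ≥ 1`; smaller limits
    -- allow no communication and are treated separately.
    obtain h1 | h1 := lt_or_ge L 1
    · exact sum_card_answers_not_fails_le_of_lt_one hconn hvars hn h1 j₀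
    · refine (sum_card_answers_not_fails_le hA hvars hn j₀).trans ?_
      refine mul_le_mul_of_nonneg_right (le_trans ?_ hsmall) hE0.le
      have hb : 0 < Real.logb 2 n.factorial := Real.logb_pos one_lt_two (by
        exact_mod_cast (by norm_num : 1 < 2).trans_le (Nat.self_le_factorial 2 |>.trans
          (Nat.factorial_le hn)))
      refine mul_le_mul_of_nonneg_left
        (Real.rpow_le_rpow (by positivity) ?_ (by linarith)) hp'.le
      rw [div_le_iff₀ hb]
      have hfl : (⌊L⌋₊ : ℝ) ≤ L := Nat.floor_le (by linarith)
      calc (⌊L⌋₊ : ℝ) + 2 ≤ 3 * L := by linarith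
        _ = _ := by
          rw [hL, loadLimit, inputBits, ← sum_mul]
          ring
  have htotal := q.sum_card_answers (n := n) (by omega)
  rw [← hE, ← sum_filter_add_sum_filter_not univ
    fun w : Fin q.numAtoms → Fin q.numVars → Equiv.Perm (Fin n) => A.Fails L (databaseOf w)]
    at htotal
  have hbad : ∑ w : Fin q.numAtoms → Fin q.numVars → Equiv.Perm (Fin n) with
      A.Fails L (databaseOf w), (#{α | α ∈ q.answers (databaseOf w)} : ℝ) ≤
      #{w : Fin q.numAtoms → Fin q.numVars → Equiv.Perm (Fin n) |
        A.Fails L (databaseOf w)} * (n : ℝ) := by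
    rw [← nsmul_eq_mul]
    exact sum_le_card_nsmul _ _ _ fun w _ => by
      exact_mod_cast card_answers_le hconn (isMatchingDatabase_databaseOf w)
  have hchar : (n : ℝ) ^ q.characteristic *
      Fintype.card (Fin q.numAtoms → Fin q.numVars → Equiv.Perm (Fin n)) * n ≤ E := by
    have hcc : Nat.card q.primalGraph.ConnectedComponent = 1 := by
      have := hconn.preconnected.subsingleton_connectedComponent
      obtain ⟨i₀⟩ := hconn.nonempty
      have : Nonempty q.primalGraph.ConnectedComponent := ⟨q.primalGraph.connectedComponentMk i₀⟩
      exact Nat.card_eq_one_iff_unique.2 ⟨inferInstance, inferInstance⟩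
    -- The expected number of answers depends on the numbers of distinct variables. Repeated
    -- variables make these smaller than the arities, which only helps since `n ≥ 1`.
    have hle : q.characteristic ≤
        (q.numVars : ℤ) + q.numAtoms - ∑ j, (#(q.vars j) : ℤ) - 1 := by
      rw [characteristic, hcc]
      have : ∑ j, (#(q.vars j) : ℤ) ≤ ∑ j, (q.arity j : ℤ) :=
        sum_le_sum fun j _ => by exact_mod_cast q.card_vars_le_arity j
      push_cast
      linarith
    have hz := zpow_le_zpow_right₀ (by linarith : (1 : ℝ) ≤ n) hle
    have hprod : ∏ j, (n : ℝ) ^ #(q.vars j) = (n : ℝ) ^ ∑ j, (#(q.vars j) : ℤ) := by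
      rw [prod_pow_eq_pow_sum, ← zpow_natCast, Nat.cast_sum]
    have hEeq : E = (n : ℝ) ^ ((q.numVars : ℤ) + q.numAtoms - ∑ j, (#(q.vars j) : ℤ) - 1) *
        ((n.factorial : ℝ) ^ q.numVars) ^ q.numAtoms * n := by
      rw [hE]
      simp only [hitCount, prod_div_distrib, prod_mul_distrib, prod_const, card_univ,
        Fintype.card_fin]
      rw [hprod, zpow_sub₀ hn0.ne', zpow_sub₀ hn0.ne', zpow_add₀ hn0.ne', zpow_natCast,
        zpow_natCast, zpow_one]
      field_simp
    rw [hEeq, Fintype.card_fun, Fintype.card_fun, Fintype.card_perm]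
    simp only [Fintype.card_fin]
    push_cast
    gcongr
  refine le_of_mul_le_mul_right ?_ hn0
  linarith

/-- The easy direction of Yao's principle: for each value of the random bits many inputs fail, so
some fixed input fails with at least the average probability. -/
theorem exists_fails_ge (hconn : q.IsConnected) (hvars : ∀ j, 2 ≤ #(q.vars j)) (hn : 2 ≤ n)
    (j₀ : Fin q.numAtoms) {ε c : ℝ} (hp : 0 < p)
    (hsmall : p * (3 * c * (∑ j, ((q.arity j : ℝ) - 1)) / (p : ℝ) ^ (1 - ε)) ^
      q.fractionalCoveringNumber ≤ 1 / 2)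
    {Ω : Type*} [MeasurableSpace Ω] (μ : Measure Ω) [IsProbabilityMeasure μ]
    (A : Ω → OneRoundAlgorithm q n p) (hA : ∀ ω, (A ω).IsSound) :
    ∃ I : q.Database n, q.IsMatchingDatabase I ∧ 1 / 2 * (n : ℝ) ^ q.characteristic ≤
      μ.real {ω | (A ω).Fails (q.loadLimit n p ε c) I} := by
  classical
  obtain ⟨w, hw⟩ := exists_le_measureReal μ
    (fun w : Fin q.numAtoms → Fin q.numVars → Equiv.Perm (Fin n) =>
      {ω | (A ω).Fails (q.loadLimit n p ε c) (databaseOf w)}) _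
    fun ω => le_card_fails (hA ω) hconn hvars hn j₀ hp hsmall
  exact ⟨_, isMatchingDatabase_databaseOf w, hw⟩

end OneRoundAlgorithm

/-- The left side is `K ^ τ * p ^ (1 - (1 - ε) τ)`, and the exponent of `p` is negative exactly when
`ε < 1 - 1/τ`. -/
theorem eventually_mul_rpow_le_half {ε τ K : ℝ} (hK : 0 ≤ K) (hτ : 0 < τ) (hε : ε < 1 - 1 / τ) :
    ∃ p₀ : ℕ, ∀ p : ℕ, p₀ ≤ p → 0 < p ∧ p * (K / (p : ℝ) ^ (1 - ε)) ^ τ ≤ 1 / 2 := by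
  have hexp : 0 < (1 - ε) * τ - 1 := by
    have : 1 / τ < 1 - ε := by linarith
    rw [div_lt_iff₀ hτ] at this
    linarith
  have h1 : Filter.Tendsto (fun p : ℕ => K ^ τ * (p : ℝ) ^ (-((1 - ε) * τ - 1))) Filter.atTop
      (nhds (K ^ τ * 0)) :=
    ((tendsto_rpow_neg_atTop hexp).comp tendsto_natCast_atTop_atTop).const_mul _
  rw [mul_zero] at h1
  obtain ⟨p₀, hp₀⟩ := Filter.eventually_atTop.1
    ((h1.eventually_le_const (by norm_num : (0 : ℝ) < 1 / 2)).and (Filter.eventually_gt_atTop 0))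
  refine ⟨p₀, fun p hp => ⟨(hp₀ p hp).2, ?_⟩⟩
  obtain ⟨h, hp0⟩ := hp₀ p hp
  have hp' : (0 : ℝ) < p := by exact_mod_cast hp0
  refine le_trans (le_of_eq ?_) h
  rw [Real.div_rpow hK (by positivity), ← Real.rpow_mul hp'.le, neg_sub, Real.rpow_sub hp',
    Real.rpow_one]
  ring

/-! ### The binary encoding is uniquely decodable -/

section Encoding

/-- Blocks of equal length can be split off one at a time. Positive length is essential, since empty
blocks would hide the length of the list; this is where `n ≥ 2` enters. -/
theorem flatMap_injective_of_length_eq {X Y : Type*} {f : X → List Y} (hf : Function.Injective f)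
    {k : ℕ} (hk : 0 < k) (hlen : ∀ x, (f x).length = k) :
    Function.Injective fun l : List X => l.flatMap f := by
  have hne : ∀ x l, f x ++ l ≠ [] := fun x l h => by
    have := hlen x
    rw [(List.append_eq_nil_iff.1 h).1, List.length_nil] at this
    omega
  intro l
  induction l with
  | nil =>
    rintro (_ | ⟨y, l'⟩) h
    · rfl
    · exact absurd (by simpa using h.symm) (hne y (l'.flatMap f))
  | cons x l ih =>
    rintro (_ | ⟨y, l'⟩) h
    · exact absurd (by simpa using h) (hne x (l.flatMap f))
    · simp only [List.flatMap_cons] at h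
      obtain ⟨h1, h2⟩ := List.append_inj h ((hlen x).trans (hlen y).symm)
      rw [hf h1, ih h2]

theorem length_flatMap_of_length_eq {X Y : Type*} {f : X → List Y} {k : ℕ}
    (hlen : ∀ x, (f x).length = k) (l : List X) : (l.flatMap f).length = l.length * k := by
  simp [List.length_flatMap, hlen]

variable {a n : ℕ}

theorem length_encodeValue (x : Fin n) : (encodeValue x).length = Nat.clog 2 n :=
  List.length_ofFn

theorem encodeValue_injective : Function.Injective (encodeValue (n := n)) := by
  intro x y h
  have h' := List.ofFn_injective h
  refine Fin.ext (Nat.eq_of_testBit_eq fun b => ?_)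
  obtain hb | hb := lt_or_ge b (Nat.clog 2 n)
  · exact congrFun h' ⟨b, hb⟩
  · have hlt : ∀ z : Fin n, (z : ℕ) < 2 ^ b := fun z =>
      z.2.trans_le ((Nat.le_pow_clog one_lt_two n).trans (Nat.pow_le_pow_right two_pos hb))
    rw [Nat.testBit_lt_two_pow (hlt x), Nat.testBit_lt_two_pow (hlt y)]

theorem length_encodeTuple (t : Tup a n) : (encodeTuple t).length = a * Nat.clog 2 n := by
  rw [encodeTuple, length_flatMap_of_length_eq length_encodeValue, List.length_ofFn]

theorem encodeTuple_injective (hn : 2 ≤ n) : Function.Injective (encodeTuple (a := a) (n := n)) :=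
  (flatMap_injective_of_length_eq encodeValue_injective (Nat.clog_pos one_lt_two hn)
    length_encodeValue).comp List.ofFn_injective

theorem length_encodeTuples (T : List (Tup a n)) :
    (encodeTuples T).length = T.length * (a * Nat.clog 2 n) :=
  length_flatMap_of_length_eq length_encodeTuple T

theorem decodeTuples_encodeTuples (ha : 0 < a) (hn : 2 ≤ n) (T : List (Tup a n)) :
    decodeTuples a n (encodeTuples T) = {t | t ∈ T} := by
  have hinj := flatMap_injective_of_length_eq (encodeTuple_injective (a := a) hn)
    (Nat.mul_pos ha (Nat.clog_pos one_lt_two hn)) length_encodeTuple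
  ext t
  constructor
  · rintro ⟨T', h, ht⟩
    rwa [hinj h] at ht
  · exact fun ht => ⟨T, rfl, ht⟩

end Encoding

/-! ### Correctness of the HyperCube algorithm -/

namespace ConjunctiveQuery

variable {q : ConjunctiveQuery} {n p : ℕ} {s : Fin q.numVars → ℕ}

theorem mem_hyperCube_report (hn : 2 ≤ n) (h : q.Hashes s n) (I : q.Database n) (u : Fin p)
    (α : Tup q.numVars n) :
    α ∈ (q.hyperCube s n p h).report u (fun j => (q.hyperCube s n p h).message j u (I j)) ↔
      ∀ j, (fun m => α (q.atom j m)) ∈ I j ∧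
        q.HyperCubeSends s h j u (fun m => α (q.atom j m)) := by
  refine forall_congr' fun j => ?_
  rw [hyperCube, decodeTuples_encodeTuples (q.arity_pos j) hn]
  simp

theorem hyperCube_output_subset (hn : 2 ≤ n) (h : q.Hashes s n) (I : q.Database n) :
    (q.hyperCube s n p h).output I ⊆ q.answers I := by
  intro α hα
  obtain ⟨u, hu⟩ := Set.mem_iUnion.1 hα
  exact fun j => ((mem_hyperCube_report hn h I u α).1 hu j).1

theorem hyperCube_output_eq (hn : 2 ≤ n) (hs : ∏ i, s i ≤ p) (h : q.Hashes s n)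
    (I : q.Database n) : (q.hyperCube s n p h).output I = q.answers I := by
  refine (hyperCube_output_subset hn h I).antisymm fun α hα => ?_
  -- The worker at the vector of hash values of `α` receives all the tuples that make up `α`; it
  -- exists because the grid has at most `p` points.
  let y : (i : Fin q.numVars) → Fin (s i) := fun i => h i (α i)
  refine Set.mem_iUnion.2 ⟨⟨finPiFinEquiv y, (finPiFinEquiv y).2.trans_le hs⟩,
    (mem_hyperCube_report hn h I _ α).2 fun j => ⟨hα j, fun m m' hm => congrArg α hm,
      y, rfl, fun m => rfl⟩⟩

open Classical in
theorem hyperCube_bitsReceived (h : q.Hashes s n) (I : q.Database n) (u : Fin p) :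
    (q.hyperCube s n p h).bitsReceived I u =
      ∑ j, #{t ∈ I j | q.HyperCubeSends s h j u t} * (q.arity j * Nat.clog 2 n) := by
  simp only [OneRoundAlgorithm.bitsReceived, hyperCube, length_encodeTuples, length_toList]

end ConjunctiveQuery

/-! ### Concentration of the load of a hypercube point -/

section Chernoff

variable {ι ρ : Type*} [Fintype ι] [DecidableEq ι] {n : ℕ} {s : ι → ℕ}

/-- The probability that random hash functions take prescribed values on a set of items with
distinct keys. -/
theorem card_hash_agree (V : Finset ι) (g : ι → ρ → Fin n) (T : Finset ρ)
    (hg : ∀ i ∈ V, Set.InjOn (g i) T) (y : (i : ι) → Fin (s i))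
    [DecidablePred fun h : (i : ι) → Fin n → Fin (s i) => ∀ t ∈ T, ∀ i ∈ V, h i (g i t) = y i] :
    (#{h : (i : ι) → Fin n → Fin (s i) | ∀ t ∈ T, ∀ i ∈ V, h i (g i t) = y i} : ℝ) =
      Fintype.card ((i : ι) → Fin n → Fin (s i)) * (∏ i ∈ V, (s i : ℝ)⁻¹) ^ #T := by
  classical
  have h1 : ({h : (i : ι) → Fin n → Fin (s i) | ∀ t ∈ T, ∀ i ∈ V, h i (g i t) = y i} : Finset _) =
      Fintype.piFinset fun i => Fintype.piFinset fun x =>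
        if i ∈ V ∧ x ∈ T.image (g i) then {y i} else univ := by
    ext h
    simp only [mem_filter, mem_univ, true_and, Fintype.mem_piFinset]
    constructor
    · intro hh i x
      split_ifs with hx
      · obtain ⟨t, ht, rfl⟩ := mem_image.1 hx.2
        exact mem_singleton.2 (hh t ht i hx.1)
      · exact mem_univ _
    · intro hh t ht i hi
      have := hh i (g i t)
      rwa [if_pos ⟨hi, mem_image_of_mem _ ht⟩, mem_singleton] at this
  rw [h1, Fintype.card_piFinset, Fintype.card_pi, Nat.cast_prod, Nat.cast_prod, ← prod_pow]
  have h2 : ∏ i ∈ V, ((s i : ℝ)⁻¹) ^ #T = ∏ i, if i ∈ V then ((s i : ℝ)⁻¹) ^ #T else 1 := by simp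
  rw [h2, ← prod_mul_distrib]
  refine prod_congr rfl fun i _ => ?_
  have hs : (s i : ℝ) ≠ 0 := by exact_mod_cast (Fin.pos (y i)).ne'
  rw [Fintype.card_piFinset, Fintype.card_fun, Fintype.card_fin, Fintype.card_fin, Nat.cast_prod]
  by_cases hi : i ∈ V
  · simp only [hi, true_and, if_true]
    rw [← card_image_of_injOn (hg i hi)]
    have h3 : ((s i : ℝ)⁻¹) ^ #(T.image (g i)) =
        ∏ x, if x ∈ T.image (g i) then (s i : ℝ)⁻¹ else 1 := by
      rw [prod_ite_mem, univ_inter, prod_const]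
    have h4 : ((s i ^ n : ℕ) : ℝ) = ∏ _x : Fin n, (s i : ℝ) := by simp
    rw [h3, h4, ← prod_mul_distrib]
    refine prod_congr rfl fun x _ => ?_
    split_ifs <;> simp [hs]
  · simp [hi]

/-- The exponential moment of the number of items that are sent to a given point. -/
theorem sum_exp_card_hash_le (V : Finset ι) (g : ι → ρ → Fin n) (R : Finset ρ)
    (hg : ∀ i ∈ V, Set.InjOn (g i) R) (y : (i : ι) → Fin (s i))
    [∀ h : (i : ι) → Fin n → Fin (s i), DecidablePred fun t => ∀ i ∈ V, h i (g i t) = y i] :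
    ∑ h : (i : ι) → Fin n → Fin (s i), Real.exp #{t ∈ R | ∀ i ∈ V, h i (g i t) = y i} ≤
      Fintype.card ((i : ι) → Fin n → Fin (s i)) *
        Real.exp (2 * (#R * ∏ i ∈ V, (s i : ℝ)⁻¹)) := by
  classical
  set κ : ℝ := ∏ i ∈ V, (s i : ℝ)⁻¹ with hκ
  set d : ℝ := Real.exp 1 - 1 with hd
  have hd0 : 0 ≤ d := by
    have := Real.add_one_le_exp 1
    linarith
  have hd2 : d ≤ 2 := by
    have := Real.exp_one_lt_d9
    linarith
  have hκ0 : 0 ≤ κ := prod_nonneg fun i _ => by positivity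
  -- Expand `exp` of the count as `∏ (1 + (e - 1) · 1_t)`. The expected indicator that all of `T`
  -- arrives is `κ ^ #T`, so the average resums to `(1 + d κ) ^ #R`, as if the tuples were
  -- independent.
  have hexp : ∀ h : (i : ι) → Fin n → Fin (s i),
      Real.exp #{t ∈ R | ∀ i ∈ V, h i (g i t) = y i} =
        ∑ T ∈ R.powerset, d ^ #T * if ∀ t ∈ T, ∀ i ∈ V, h i (g i t) = y i then 1 else 0 := by
    intro h
    have h1 : Real.exp #{t ∈ R | ∀ i ∈ V, h i (g i t) = y i} =
        ∏ t ∈ R, (1 + if ∀ i ∈ V, h i (g i t) = y i then d else 0) := by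
      rw [← mul_one (#{t ∈ R | ∀ i ∈ V, h i (g i t) = y i} : ℝ), Real.exp_nat_mul, ← prod_const,
        prod_filter]
      refine prod_congr rfl fun t _ => ?_
      split_ifs <;> simp [hd]
    rw [h1, prod_one_add]
    refine sum_congr rfl fun T _ => ?_
    split_ifs with hT
    · rw [prod_congr rfl fun t ht => if_pos (hT t ht), prod_const, mul_one]
    · push Not at hT
      obtain ⟨t, ht, i, hi, hne⟩ := hT
      rw [mul_zero]
      exact prod_eq_zero ht (if_neg fun hall => hne (hall i hi))
  simp only [hexp]
  rw [sum_comm]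
  have hT : ∀ T ∈ R.powerset, ∑ h : (i : ι) → Fin n → Fin (s i),
      d ^ #T * (if ∀ t ∈ T, ∀ i ∈ V, h i (g i t) = y i then (1 : ℝ) else 0) =
      Fintype.card ((i : ι) → Fin n → Fin (s i)) * ∏ _t ∈ T, d * κ := by
    intro T hT
    have := card_hash_agree V g T (fun i hi => (hg i hi).mono (mem_powerset.1 hT)) y
    rw [← mul_sum, sum_boole, this, prod_const, mul_pow]
    ring
  rw [sum_congr rfl hT, ← mul_sum, ← prod_one_add, prod_const]
  gcongr
  calc (1 + d * κ) ^ #R ≤ Real.exp (d * κ) ^ #R := by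
        gcongr
        linarith [Real.add_one_le_exp (d * κ)]
    _ = Real.exp (#R * (d * κ)) := (Real.exp_nat_mul _ _).symm
    _ ≤ _ := by
        refine Real.exp_le_exp.2 ?_
        have : (0 : ℝ) ≤ #R * κ := by positivity
        nlinarith

/-- A Chernoff bound for the number of items that are sent to a given point. -/
theorem card_hash_gt_le (V : Finset ι) (g : ι → ρ → Fin n) (R : Finset ρ)
    (hg : ∀ i ∈ V, Set.InjOn (g i) R) (y : (i : ι) → Fin (s i))
    [∀ h : (i : ι) → Fin n → Fin (s i), DecidablePred fun t => ∀ i ∈ V, h i (g i t) = y i]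
    {B : ℝ} (hB : #R * ∏ i ∈ V, (s i : ℝ)⁻¹ ≤ B) :
    (#{h : (i : ι) → Fin n → Fin (s i) |
        5 * B < #{t ∈ R | ∀ i ∈ V, h i (g i t) = y i}} : ℝ) ≤
      Fintype.card ((i : ι) → Fin n → Fin (s i)) * Real.exp (-(3 * B)) := by
  have h1 : (#{h : (i : ι) → Fin n → Fin (s i) |
        5 * B < #{t ∈ R | ∀ i ∈ V, h i (g i t) = y i}} : ℝ) * Real.exp (5 * B) ≤
      ∑ h : (i : ι) → Fin n → Fin (s i), Real.exp #{t ∈ R | ∀ i ∈ V, h i (g i t) = y i} := by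
    rw [← nsmul_eq_mul]
    refine (card_nsmul_le_sum _ (fun h : (i : ι) → Fin n → Fin (s i) =>
      Real.exp #{t ∈ R | ∀ i ∈ V, h i (g i t) = y i}) _ fun h hh => ?_).trans
      (sum_le_sum_of_subset_of_nonneg (filter_subset _ _) fun _ _ _ => (Real.exp_pos _).le)
    exact Real.exp_le_exp.2 (mem_filter.1 hh).2.le
  refine le_of_mul_le_mul_right (h1.trans ((sum_exp_card_hash_le V g R hg y).trans ?_))
    (Real.exp_pos (5 * B))
  -- Markov's inequality for the exponential: the moment is at most `e ^ (2B)` and the threshold is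
  -- `e ^ (5B)`.
  rw [mul_assoc, ← Real.exp_add]
  gcongr
  linarith

end Chernoff

/-! ### The load of the HyperCube algorithm -/

theorem nat_mul_clog_le {n : ℕ} (hn : 2 ≤ n) :
    (n : ℝ) * Nat.clog 2 n ≤ 4 * Real.logb 2 n.factorial := by
  have hn' : (2 : ℝ) ≤ n := by exact_mod_cast hn
  -- Pair the factor `i + 1` of one factorial with `n - i` of the other; each product is at least
  -- `n`.
  have h1 : n ^ n ≤ n.factorial ^ 2 := by
    rw [← prod_range_add_one_eq_factorial, sq]
    nth_rewrite 2 [← prod_range_reflect]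
    rw [← prod_mul_distrib]
    conv_lhs => rw [← card_range n, ← prod_const, card_range]
    refine prod_le_prod' fun i hi => ?_
    have hi' := mem_range.1 hi
    obtain ⟨k, rfl⟩ : ∃ k, n = i + 1 + k := ⟨n - (i + 1), by omega⟩
    have : i + 1 + k - 1 - i + 1 = k + 1 := by omega
    rw [this]
    nlinarith [Nat.zero_le (i * k)]
  have h2 : (n : ℝ) * Real.logb 2 n ≤ 2 * Real.logb 2 n.factorial := by
    have := Real.logb_le_logb_of_le one_lt_two (by positivity)
      (by exact_mod_cast h1 : (n : ℝ) ^ n ≤ (n.factorial : ℝ) ^ 2)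
    rwa [Real.logb_pow, Real.logb_pow, Nat.cast_ofNat] at this
  have h3 : (Nat.clog 2 n : ℝ) ≤ 2 * Real.logb 2 n := by
    have hlog1 : 1 ≤ Real.logb 2 n := by
      rw [Real.le_logb_iff_rpow_le one_lt_two (by linarith)]
      simpa using hn'
    have : (Nat.clog 2 n : ℝ) < Real.logb 2 n + 1 := by
      have hceil : Nat.clog 2 n = ⌈Real.logb 2 n⌉₊ := by
        exact_mod_cast (Real.natCeil_logb_natCast 2 n).symm
      rw [hceil]
      exact Nat.ceil_lt_add_one (by linarith)
    linarith
  nlinarith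

theorem uniformOn_univ_real_eq {H : Type*} [MeasurableSpace H] [MeasurableSingletonClass H]
    [Fintype H] [Nonempty H] (P : H → Prop) [DecidablePred P] :
    (ProbabilityTheory.uniformOn (Set.univ : Set H)).real {h | P h} = #{h | P h} / Fintype.card H := by
  have : {h | P h} = ((({h | P h} : Finset H)) : Set H) := by ext; simp
  rw [Measure.real, ProbabilityTheory.uniformOn_univ, this, Measure.count_apply_finset]
  simp [ENNReal.toReal_div]

namespace ConjunctiveQuery

variable {q : ConjunctiveQuery} {n p : ℕ}

/-- The unrounded share is at least 1, so rounding down loses at most a factor 2. -/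
theorem IsFractionalVertexCover.half_le_shares {v : Fin q.numVars → ℝ}
    (hv : q.IsFractionalVertexCover v) (hp : 1 ≤ p) (i : Fin q.numVars) :
    (p : ℝ) ^ (v i / ∑ i', v i') / 2 ≤ q.shares v p i := by
  have h1 : (1 : ℝ) ≤ (p : ℝ) ^ (v i / ∑ i', v i') :=
    Real.one_le_rpow (by exact_mod_cast hp) (div_nonneg (hv.1 i) (sum_nonneg fun i _ => hv.1 i))
  have h2 := Nat.lt_floor_add_one ((p : ℝ) ^ (v i / ∑ i', v i'))
  have h3 : (1 : ℝ) ≤ ⌊(p : ℝ) ^ (v i / ∑ i', v i')⌋₊ := by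
    exact_mod_cast (Nat.one_le_floor_iff _).2 h1
  rw [shares]
  linarith

theorem IsFractionalVertexCover.prod_shares_le {v : Fin q.numVars → ℝ}
    (hv : q.IsFractionalVertexCover v) (hp : 1 ≤ p) (j₀ : Fin q.numAtoms) :
    ∏ i, q.shares v p i ≤ p := by
  have hp' : (0 : ℝ) < p := by exact_mod_cast hp
  have hτ := hv.one_le_sum j₀
  have : (∏ i, (q.shares v p i : ℝ)) ≤ p := by
    calc ∏ i, (q.shares v p i : ℝ) ≤ ∏ i, (p : ℝ) ^ (v i / ∑ i', v i') :=
          prod_le_prod (fun _ _ => Nat.cast_nonneg _) fun i _ => Nat.floor_le (by positivity)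
      _ = p := by
          rw [← Real.rpow_sum_of_pos hp', ← sum_div, div_self (by linarith), Real.rpow_one]
  exact_mod_cast this

/-- The left side is the probability that a tuple of `S_j` is hashed to a given point. The cover
constraint of the atom gives the exponent `1/τ`, and rounding costs at most 2 per variable. -/
theorem IsFractionalVertexCover.prod_inv_shares_le {v : Fin q.numVars → ℝ}
    (hv : q.IsFractionalVertexCover v) (hp : 1 ≤ p) (j : Fin q.numAtoms) :
    ∏ i ∈ q.vars j, (q.shares v p i : ℝ)⁻¹ ≤
      2 ^ q.numVars / (p : ℝ) ^ (1 / ∑ i, v i) := by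
  have hp' : (0 : ℝ) < p := by exact_mod_cast hp
  have hτ := hv.one_le_sum j
  calc ∏ i ∈ q.vars j, (q.shares v p i : ℝ)⁻¹
      ≤ ∏ i ∈ q.vars j, 2 / (p : ℝ) ^ (v i / ∑ i', v i') := by
        refine prod_le_prod (fun _ _ => by positivity) fun i _ => ?_
        rw [← inv_div]
        exact inv_anti₀ (by positivity) (hv.half_le_shares hp i)
    _ = 2 ^ #(q.vars j) / (p : ℝ) ^ ((∑ i ∈ q.vars j, v i) / ∑ i, v i) := by
        rw [prod_div_distrib, prod_const, ← Real.rpow_sum_of_pos hp', sum_div]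
    _ ≤ _ := by
        gcongr
        · exact one_le_two
        · simpa using card_le_univ (q.vars j)
        · exact_mod_cast hp
        · exact hv.2 j

open Classical in
/-- With high probability, no worker receives too many tuples of `S_j`. -/
theorem card_hyperCubeSends_gt_le {s : Fin q.numVars → ℕ} {j : Fin q.numAtoms}
    {R : Finset (Tup (q.arity j) n)} (hR : IsMatchingRelation R) (u : Fin p) {B : ℝ} (hB0 : 0 ≤ B)
    (hB : n * ∏ i ∈ q.vars j, (s i : ℝ)⁻¹ ≤ B) :
    (#{h : q.Hashes s n | 5 * B < #{t ∈ R | q.HyperCubeSends s h j u t}} : ℝ) ≤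
      Fintype.card (q.Hashes s n) * Real.exp (-(3 * B)) := by
  by_cases hy : ∃ y, q.LocatedAt s u y
  · obtain ⟨y, hy⟩ := hy
    have huniq : ∀ y', q.LocatedAt s u y' → y' = y := fun y' hy' =>
      finPiFinEquiv.injective (Fin.ext (hy'.trans hy.symm))
    have hpos : ∀ i : {i // i ∈ q.vars j}, ∃ m, q.atom j m = i := fun i => by
      simpa [vars] using i.2
    choose m hm using hpos
    let g : Fin q.numVars → Tup (q.arity j) n → Fin n := fun i t =>
      if hi : i ∈ q.vars j then t (m ⟨i, hi⟩) else t ⟨0, q.arity_pos j⟩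
    have hg : ∀ i ∈ q.vars j, Set.InjOn (g i) R := fun i hi => by
      simp only [g, hi, dif_pos]
      exact (hR.2 _).injOn
    refine le_trans (Nat.cast_le.2 (card_le_card fun h hh => ?_))
      (card_hash_gt_le (q.vars j) g R hg y (B := B) (by rwa [hR.1]))
    simp only [mem_filter, mem_univ, true_and] at hh ⊢
    refine hh.trans_le (Nat.cast_le.2 (card_le_card fun t ht => ?_))
    simp only [mem_filter] at ht ⊢
    obtain ⟨htR, -, y', hy', ht⟩ := ht
    refine ⟨htR, fun i hi => ?_⟩
    have := ht (m ⟨i, hi⟩)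
    rw [hm, huniq y' hy'] at this
    simpa only [g, hi, dif_pos] using this
  · push Not at hy
    have : ∀ h : q.Hashes s n, ({t ∈ R | q.HyperCubeSends s h j u t} : Finset _) = ∅ := fun h =>
      filter_eq_empty_iff.2 fun t _ ⟨_, y, hy', _⟩ => hy y hy'
    simp only [this, card_empty, Nat.cast_zero]
    rw [filter_false_of_mem fun _ _ => by linarith]
    simp only [card_empty, Nat.cast_zero]
    positivity

open Classical in
theorem card_exists_hyperCubeSends_gt_le {s : Fin q.numVars → ℕ} {I : q.Database n}
    (hI : q.IsMatchingDatabase I) {B : ℝ} (hB0 : 0 ≤ B)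
    (hB : ∀ j, n * ∏ i ∈ q.vars j, (s i : ℝ)⁻¹ ≤ B) :
    (#{h : q.Hashes s n |
        ∃ (u : Fin p) (j : _), 5 * B < #{t ∈ I j | q.HyperCubeSends s h j u t}} : ℝ) ≤
      p * q.numAtoms * (Fintype.card (q.Hashes s n) * Real.exp (-(3 * B))) := by
  have h1 : #{h : q.Hashes s n |
        ∃ (u : Fin p) (j : _), 5 * B < #{t ∈ I j | q.HyperCubeSends s h j u t}} ≤
      ∑ z : Fin p × Fin q.numAtoms,
        #{h : q.Hashes s n | 5 * B < #{t ∈ I z.2 | q.HyperCubeSends s h z.2 z.1 t}} :=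
    card_le_sum_card_of_forall_exists _ _ fun h hh => by
      obtain ⟨u, j, huj⟩ := (mem_filter.1 hh).2
      exact ⟨(u, j), mem_filter.2 ⟨mem_univ _, huj⟩⟩
  refine (Nat.cast_le.2 h1).trans ?_
  rw [Nat.cast_sum]
  refine (sum_le_card_nsmul _ _ _ fun z _ =>
    card_hyperCubeSends_gt_le (hI z.2) z.1 hB0 (hB z.2)).trans_eq ?_
  simp [nsmul_eq_mul]

/-- The output is always right, so failure means that some worker gets more than `5 K D` tuples of
some relation. The union bound over workers and atoms costs `p ≤ e ^ D` and `ℓ ≤ e ^ (ℓ D)`, where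
`ℓ` is the number of atoms; `K = 2 ^ k + ℓ` is large enough for `e ^ (-3 K D)` to absorb both and
leave `e ^ (-D)`. The load constant 20 is 5 from the Chernoff threshold times 4 from comparing `n
⌈log₂ n⌉` with `log₂ n!`. -/
theorem IsFractionalVertexCover.hyperCube_fails_le {v : Fin q.numVars → ℝ}
    (hv : q.IsFractionalVertexCover v) (hvars : ∀ j, 2 ≤ #(q.vars j)) (j₀ : Fin q.numAtoms)
    {ε : ℝ} (hε : ε = 1 - 1 / ∑ i, v i) (hp : 1 ≤ p) (hn : 2 ≤ n)
    (hnp : 2 * (p : ℝ) ^ (1 - ε) * Real.log p ≤ n) {I : q.Database n}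
    (hI : q.IsMatchingDatabase I) :
    (ProbabilityTheory.uniformOn (Set.univ : Set (q.Hashes (q.shares v p) n))).real
        {h | (q.hyperCube (q.shares v p) n p h).Fails (q.loadLimit n p ε
          (20 * (2 ^ q.numVars + q.numAtoms) * ∑ j, (q.arity j : ℝ))) I} ≤
      Real.exp (-(n / (p : ℝ) ^ (1 - ε))) := by
  classical
  have hε' : 1 - ε = 1 / ∑ i, v i := by linarith
  have hp' : (1 : ℝ) ≤ p := by exact_mod_cast hp
  have hp0 : (0 : ℝ) < p := by linarith
  have hpe : 0 < (p : ℝ) ^ (1 - ε) := by positivity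
  have hn' : (2 : ℝ) ≤ n := by exact_mod_cast hn
  set D : ℝ := n / (p : ℝ) ^ (1 - ε) with hD
  have hD0 : 0 < D := by positivity
  have hlogD : 2 * Real.log p ≤ D := by
    rw [hD, le_div_iff₀ hpe]
    linarith
  -- For `p = 1` this is `n ≥ 2`; for `p ≥ 2` the constant 2 in `hnp` gives `D ≥ 2 log 2 > 1`.
  have hD1 : 1 ≤ D := by
    obtain rfl | h2 := hp.eq_or_lt
    · rw [hD, Nat.cast_one, Real.one_rpow, div_one]
      linarith
    · have h2' : (2 : ℝ) ≤ p := by exact_mod_cast h2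
      have := Real.log_le_log two_pos h2'
      have := Real.log_two_gt_d9
      linarith
  set K : ℝ := 2 ^ q.numVars + q.numAtoms with hK
  have hK0 : 0 < K := by positivity
  have hB : ∀ j, n * ∏ i ∈ q.vars j, (q.shares v p i : ℝ)⁻¹ ≤ K * D := fun j => by
    calc n * ∏ i ∈ q.vars j, (q.shares v p i : ℝ)⁻¹
        ≤ n * (2 ^ q.numVars / (p : ℝ) ^ (1 - ε)) := by
          rw [hε']
          gcongr
          exact hv.prod_inv_shares_le hp j
      _ = 2 ^ q.numVars * D := by rw [hD]; ring
      _ ≤ K * D := by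
          rw [hK]
          gcongr
          exact le_add_of_nonneg_right (Nat.cast_nonneg _)
  have hshares : ∀ i, 0 < q.shares v p i := fun i => by
    have := hv.half_le_shares hp i
    have h2 : (0 : ℝ) < q.shares v p i := lt_of_lt_of_le (by positivity) this
    exact_mod_cast h2
  have hne : Nonempty (q.Hashes (q.shares v p) n) := ⟨fun i _ => ⟨0, hshares i⟩⟩
  have hcard : (0 : ℝ) < Fintype.card (q.Hashes (q.shares v p) n) := by
    exact_mod_cast Fintype.card_pos
  rw [uniformOn_univ_real_eq, div_le_iff₀ hcard]
  have hfail : ∀ h : q.Hashes (q.shares v p) n, (q.hyperCube (q.shares v p) n p h).Fails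
      (q.loadLimit n p ε (20 * K * ∑ j, (q.arity j : ℝ))) I →
      ∃ (u : Fin p) (j : _),
        5 * (K * D) < #{t ∈ I j | q.HyperCubeSends (q.shares v p) h j u t} := by
    rintro h (⟨u, hu⟩ | hout)
    · by_contra! hcon
      refine hu.not_ge ?_
      rw [hyperCube_bitsReceived]
      push_cast
      -- Every arity is at least 2, so the input size is at least `log₂ n!`.
      have hA : (1 : ℝ) ≤ ∑ j, ((q.arity j : ℝ) - 1) := by
        have hterm : ∀ j, (1 : ℝ) ≤ (q.arity j : ℝ) - 1 := fun j => by
          have : (2 : ℝ) ≤ q.arity j := by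
            exact_mod_cast (hvars j).trans (q.card_vars_le_arity j)
          linarith
        exact (hterm j₀).trans (single_le_sum (f := fun j => (q.arity j : ℝ) - 1)
          (fun j _ => by linarith [hterm j]) (mem_univ j₀))
      have hlog : 0 ≤ Real.logb 2 n.factorial :=
        Real.logb_nonneg one_lt_two (by exact_mod_cast n.factorial_pos)
      calc ∑ j, (#{t ∈ I j | q.HyperCubeSends (q.shares v p) h j u t} : ℝ) *
            (q.arity j * Nat.clog 2 n)
          ≤ ∑ j, 5 * (K * D) * (q.arity j * Nat.clog 2 n) := by
            gcongr with j _
            exact hcon u j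
        _ = 5 * K * (∑ j, (q.arity j : ℝ)) * (n * Nat.clog 2 n) / (p : ℝ) ^ (1 - ε) := by
            rw [← mul_sum, ← sum_mul, hD]
            ring
        _ ≤ 5 * K * (∑ j, (q.arity j : ℝ)) * (4 * Real.logb 2 n.factorial) /
              (p : ℝ) ^ (1 - ε) := by
            exact div_le_div_of_nonneg_right
              (mul_le_mul_of_nonneg_left (nat_mul_clog_le hn) (by positivity)) hpe.le
        _ ≤ 5 * K * (∑ j, (q.arity j : ℝ)) *
              (4 * ((∑ j, ((q.arity j : ℝ) - 1)) * Real.logb 2 n.factorial)) /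
              (p : ℝ) ^ (1 - ε) := by
            gcongr
            exact le_mul_of_one_le_left hlog hA
        _ = _ := by
            rw [loadLimit, inputBits, ← sum_mul]
            ring
    · exact absurd (hyperCube_output_eq hn (hv.prod_shares_le hp j₀) h I) hout
  refine (Nat.cast_le.2 (card_le_card (monotone_filter_right _ fun h _ => hfail h))).trans
    ((card_exists_hyperCubeSends_gt_le hI (by positivity) hB).trans ?_)
  have hpexp : (p : ℝ) ≤ Real.exp D := by
    rw [← Real.log_le_iff_le_exp hp0]
    have := Real.log_nonneg hp'
    linarith
  have hlexp : (q.numAtoms : ℝ) ≤ Real.exp (q.numAtoms * D) := by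
    have h1 := Real.add_one_le_exp (q.numAtoms * D)
    have h2 : (q.numAtoms : ℝ) ≤ q.numAtoms * D := le_mul_of_one_le_right (Nat.cast_nonneg _) hD1
    linarith
  calc (p : ℝ) * q.numAtoms * (Fintype.card (q.Hashes (q.shares v p) n) *
        Real.exp (-(3 * (K * D))))
      ≤ Real.exp D * Real.exp (q.numAtoms * D) * (Fintype.card (q.Hashes (q.shares v p) n) *
        Real.exp (-(3 * (K * D)))) := by gcongr
    _ = Real.exp (D + q.numAtoms * D - 3 * (K * D)) *
          Fintype.card (q.Hashes (q.shares v p) n) := by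
        rw [sub_eq_add_neg, Real.exp_add, Real.exp_add]
        ring
    _ ≤ _ := by
        gcongr
        have h1 : (1 : ℝ) ≤ 2 ^ q.numVars := one_le_pow₀ one_le_two
        have h2 : (0 : ℝ) ≤ q.numAtoms * D := by positivity
        have h3 : D ≤ 2 ^ q.numVars * D := le_mul_of_one_le_left hD0.le h1
        rw [hK]
        linarith

end ConjunctiveQuery

theorem theorem1 (q : ConjunctiveQuery) (hconn : q.IsConnected)
    (hvars : ∀ j, 2 ≤ (q.vars j).card) :
    -- lower bound, already on matching databases
    (∀ ε c : ℝ, 0 ≤ ε → ε < 1 - 1 / q.fractionalCoveringNumber → 0 < c →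
      ∃ δ : ℝ, 0 < δ ∧ ∃ p₀ : ℕ, ∀ p n : ℕ, p₀ ≤ p → 2 ≤ n →
        ∀ {Ω : Type*} [MeasurableSpace Ω] (μ : Measure Ω) [IsProbabilityMeasure μ]
          (A : Ω → OneRoundAlgorithm q n p), (∀ ω, (A ω).IsSound) →
          ∃ I : q.Database n, q.IsMatchingDatabase I ∧
            δ * (n : ℝ) ^ q.characteristic ≤
              μ.real {ω | (A ω).Fails (q.loadLimit n p ε c) I}) ∧
    -- the optimum of the vertex covering linear program is attained
    (∃ v, q.IsFractionalVertexCover v ∧ ∑ i, v i = q.fractionalCoveringNumber) ∧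
    -- upper bound on matching databases, by the HyperCube algorithm
    (∀ v, q.IsFractionalVertexCover v → ∀ ε : ℝ, ε = 1 - 1 / ∑ i, v i →
      ∃ c C δ : ℝ, 0 < c ∧ 0 < C ∧ 0 < δ ∧ ∀ p n : ℕ, 1 ≤ p → 2 ≤ n →
        C * (p : ℝ) ^ (1 - ε) * Real.log p ≤ n →
          (∀ h : q.Hashes (q.shares v p) n, (q.hyperCube (q.shares v p) n p h).IsSound) ∧
          ∀ I : q.Database n, q.IsMatchingDatabase I →
            (ProbabilityTheory.uniformOn (Set.univ : Set (q.Hashes (q.shares v p) n))).real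
                {h | (q.hyperCube (q.shares v p) n p h).Fails (q.loadLimit n p ε c) I} ≤
              Real.exp (-(δ * (n / (p : ℝ) ^ (1 - ε))))) := by
  obtain ⟨i₀⟩ := hconn.nonempty
  obtain ⟨j₀, -⟩ := q.occurs i₀
  refine ⟨fun ε c _ hε hc => ?_, q.exists_cover_eq_fractionalCoveringNumber, fun v hv ε hε => ?_⟩
  · have hA : 0 ≤ ∑ j, ((q.arity j : ℝ) - 1) := sum_nonneg fun j _ => by
      have : (1 : ℝ) ≤ q.arity j := by exact_mod_cast q.arity_pos j
      linarith
    have hτ := q.one_le_fractionalCoveringNumber j₀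
    obtain ⟨p₀, hp₀⟩ := eventually_mul_rpow_le_half (mul_nonneg (by positivity : 0 ≤ 3 * c) hA)
      (by linarith) hε
    exact ⟨1 / 2, by norm_num, p₀, fun p n hp hn Ω _ μ _ A hsound =>
      OneRoundAlgorithm.exists_fails_ge hconn hvars hn j₀ (hp₀ p hp).1 (hp₀ p hp).2 μ A hsound⟩
  · have hsum : (0 : ℝ) < ∑ j, (q.arity j : ℝ) :=
      sum_pos (fun j _ => by exact_mod_cast q.arity_pos j) ⟨j₀, mem_univ j₀⟩
    refine ⟨20 * (2 ^ q.numVars + q.numAtoms) * ∑ j, (q.arity j : ℝ), 2, 1, by positivity,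
      two_pos, one_pos, fun p n hp hn hnp =>
        ⟨fun h I _ => ConjunctiveQuery.hyperCube_output_subset hn h I, fun I hI => ?_⟩⟩
    rw [one_mul]
    exact hv.hyperCube_fails_le hvars j₀ hε hp hn hnp hI
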